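/- Let $D\subseteq\mathbb R^2$ be open, let $2\le n\le\infty$, and let $\lambda\colon D\to\mathbb R$ be of class $C^n$ and satisfy on $D$ $$\Delta\lambda:=\lambda_{uu}+\lambda_{vv}=-e^{\lambda},\qquad \lambda_u\,\lambda_v\neq 0 .$$ For a regular parametrized surface $x=x(u,v)$ of class $C^3$ in $\mathbb R^3$, let $E,F,G$ and $L,M,N$ be the coefficients of its first and second fundamental forms with respect to the unit normal $l=\dfrac{x_u\times x_v}{|x_u\times x_v|}$. The parameters are called principal if $F=M=0$; then $\nu_1=L/E$ and $\nu_2=N/G$ are the principal curvatures, and $\gamma_1,\gamma_2$ denote the geodesic curvatures (with respect to $l$) of the $u$-lines and of the $v$-lines, that is, $\gamma_1=-\dfrac{E_v}{2E\sqrt G}$ and $\gamma_2=\dfrac{G_u}{2G\sqrt E}$. The surface, referred to principal parameters, is strongly regular if $(\nu_1-\nu_2)\gamma_1\gamma_2\ne0$ everywhere. Consider surfaces, parametrized by principal parameters $(u,v)$, that are minimal, strongly regular, and have the invariants $$\nu_1=e^{\lambda},\quad \nu_2=-e^{\lambda},\quad \gamma_1=\tfrac1{\sqrt2}\,e^{\lambda/2}\lambda_v,\quad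 \gamma_2=-\tfrac1{\sqrt2}\,e^{\lambda/2}\lambda_u. \tag{$*$}$$ 1. (Existence) Every point of $D$ has a connected open neighbourhood $D_0\subseteq D$ over which there is a minimal strongly regular surface with the invariants $(*)$; it can be chosen of class $C^{n+1}$ (hence $C^\infty$ if $\lambda$ is $C^\infty$). 2. (Uniqueness up to a motion) If $D_0\subseteq D$ is open and connected and $x,y$ are two minimal strongly regular surfaces over $D_0$ with the invariants $(*)$, then there is a motion $g$ (an orientation-preserving isometry of $\mathbb R^3$) with $y=g\circ x$ on $D_0$. -/

import Mathlib

noncomputable section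

namespace PrincipalSurface

/-- Euclidean three-space. -/
abbrev E3 : Type := EuclideanSpace ℝ (Fin 3)

/-- The partial derivative `f_u` of a function of the parameters `(u, v)`. -/
def du {V : Type*} [NormedAddCommGroup V] [NormedSpace ℝ V] (f : ℝ × ℝ → V) (p : ℝ × ℝ) : V :=
  fderiv ℝ f p (1, 0)

/-- The partial derivative `f_v` of a function of the parameters `(u, v)`. -/
def dv {V : Type*} [NormedAddCommGroup V] [NormedSpace ℝ V] (f : ℝ × ℝ → V) (p : ℝ × ℝ) : V :=
  fderiv ℝ f p (0, 1)

/-- The Laplacian `f_uu + f_vv` in the parameter plane. -/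
def laplacian (f : ℝ × ℝ → ℝ) (p : ℝ × ℝ) : ℝ :=
  du (du f) p + dv (dv f) p

/-- The vector product of Euclidean three-space. -/
def cross (a b : E3) : E3 :=
  WithLp.toLp 2 (crossProduct (WithLp.ofLp a) (WithLp.ofLp b))

/-- The unit normal `l`, chosen such that `x_u, x_v, l` is right oriented. -/
def normal (x : ℝ × ℝ → E3) (p : ℝ × ℝ) : E3 :=
  ‖cross (du x p) (dv x p)‖⁻¹ • cross (du x p) (dv x p)

/-! Coefficients of the first and of the second fundamental form. -/

def coeffE (x : ℝ × ℝ → E3) (p : ℝ × ℝ) : ℝ := inner ℝ (du x p) (du x p)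

def coeffF (x : ℝ × ℝ → E3) (p : ℝ × ℝ) : ℝ := inner ℝ (du x p) (dv x p)

def coeffG (x : ℝ × ℝ → E3) (p : ℝ × ℝ) : ℝ := inner ℝ (dv x p) (dv x p)

def coeffL (x : ℝ × ℝ → E3) (p : ℝ × ℝ) : ℝ := inner ℝ (du (du x) p) (normal x p)

def coeffM (x : ℝ × ℝ → E3) (p : ℝ × ℝ) : ℝ := inner ℝ (dv (du x) p) (normal x p)

def coeffN (x : ℝ × ℝ → E3) (p : ℝ × ℝ) : ℝ := inner ℝ (dv (dv x) p) (normal x p)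

/-- The mean curvature. -/
def meanCurvature (x : ℝ × ℝ → E3) (p : ℝ × ℝ) : ℝ :=
  (coeffE x p * coeffN x p - 2 * coeffF x p * coeffM x p + coeffG x p * coeffL x p) /
    (2 * (coeffE x p * coeffG x p - coeffF x p ^ 2))

/-- The normal curvature of the `u`-lines; it is the first principal curvature when the
parameters are principal. -/
def nu₁ (x : ℝ × ℝ → E3) (p : ℝ × ℝ) : ℝ := coeffL x p / coeffE x p

/-- The normal curvature of the `v`-lines; it is the second principal curvature when the
parameters are principal. -/
def nu₂ (x : ℝ × ℝ → E3) (p : ℝ × ℝ) : ℝ := coeffN x p / coeffG x p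

/-- The signed geodesic curvature, on a surface with unit normal `l`, of a curve with velocity
`c'` and acceleration `c''`. -/
def geodesicCurvature (l c' c'' : E3) : ℝ := inner ℝ c'' (cross l c') / ‖c'‖ ^ 3

/-- The geodesic curvature of the `u`-lines. In principal parameters it is the coefficient of
`Y = x_v / √G` in the derivative of `X = x_u / √E` in the direction of `X`, and equals
`- E_v / (2 E √G)`. -/
def gamma₁ (x : ℝ × ℝ → E3) (p : ℝ × ℝ) : ℝ :=
  geodesicCurvature (normal x p) (du x p) (du (du x) p)

/-- The geodesic curvature of the `v`-lines. In principal parameters it is minus the coefficient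
of `X` in the derivative of `Y` in the direction of `Y`, and equals `G_u / (2 G √E)`. -/
def gamma₂ (x : ℝ × ℝ → E3) (p : ℝ × ℝ) : ℝ :=
  geodesicCurvature (normal x p) (dv x p) (dv (dv x) p)

/-- A regular parametrized surface over `D`, of class `C³` (the regularity at which the Codazzi
equations make sense). -/
structure IsRegular (x : ℝ × ℝ → E3) (D : Set (ℝ × ℝ)) : Prop where
  contDiffOn : ContDiffOn ℝ 3 x D
  linearIndependent : ∀ p ∈ D, LinearIndependent ℝ ![du x p, dv x p]

/-- The parametric lines are principal lines: `F = M = 0`. -/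
def IsPrincipal (x : ℝ × ℝ → E3) (D : Set (ℝ × ℝ)) : Prop :=
  ∀ p ∈ D, coeffF x p = 0 ∧ coeffM x p = 0

/-- A strongly regular surface, referred to principal parameters. -/
structure IsStronglyRegular (x : ℝ × ℝ → E3) (D : Set (ℝ × ℝ)) : Prop where
  regular : IsRegular x D
  principal : IsPrincipal x D
  ne_zero : ∀ p ∈ D, (nu₁ x p - nu₂ x p) * gamma₁ x p * gamma₂ x p ≠ 0

/-- A minimal surface: the mean curvature vanishes. -/
def IsMinimal (x : ℝ × ℝ → E3) (D : Set (ℝ × ℝ)) : Prop :=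
  ∀ p ∈ D, meanCurvature x p = 0

/-- The four invariants of `x` on `D` are the functions `a₁, a₂` (principal curvatures) and
`b₁, b₂` (principal geodesic curvatures). -/
def HasInvariants (x : ℝ × ℝ → E3) (D : Set (ℝ × ℝ)) (a₁ a₂ b₁ b₂ : ℝ × ℝ → ℝ) : Prop :=
  ∀ p ∈ D, nu₁ x p = a₁ p ∧ nu₂ x p = a₂ p ∧ gamma₁ x p = b₁ p ∧ gamma₂ x p = b₂ p

/-- Over `D`, `x` is a minimal strongly regular surface in principal parameters whose invariants
are the ones prescribed by the function `lam`. -/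
structure IsGeneratedBy (lam : ℝ × ℝ → ℝ) (x : ℝ × ℝ → E3) (D : Set (ℝ × ℝ)) : Prop where
  stronglyRegular : IsStronglyRegular x D
  minimal : IsMinimal x D
  invariants : HasInvariants x D
    (fun p => Real.exp (lam p))
    (fun p => -Real.exp (lam p))
    (fun p => 1 / √2 * Real.exp (lam p / 2) * dv lam p)
    (fun p => -(1 / √2) * Real.exp (lam p / 2) * du lam p)

/-- A motion of Euclidean three-space: an orientation-preserving isometry. -/
def IsMotion (g : E3 ≃ᵃⁱ[ℝ] E3) : Prop :=
  LinearMap.det (g.linearIsometryEquiv.toLinearEquiv : E3 →ₗ[ℝ] E3) = 1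

end PrincipalSurface

end

/-! Put σ = `speed lam` = e^(-λ/2)/√2 and τ = `normalSpeed lam` = e^(λ/2)/√2, so that 2τσ = 1 and
2τ² = e^λ. The proof replaces the surface by its principal frame X = x_u/√E, Y = x_v/√G, l, and
shows that the geometric conditions amount to x_u = σX, x_v = σY together with a linear system for
(X, Y, l) whose coefficients depend on λ alone.

From surface to system (`IsGeneratedBy.isMovingFrame`): since ν₁ = -ν₂ = e^λ, the Codazzi equations
read E_v = -λ_v E and G_u = -λ_u G. Hence γ₁ = λ_v/(2√G) and γ₂ = -λ_u/(2√E), and as λ_u and λ_v do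
not vanish, the prescribed values of γ₁, γ₂ force √E = √G = σ. All coefficients of the Gauss and
Weingarten formulas are then known.

From system to surface (`exists_surface_and_movingFrame`, `isGeneratedBy_of_movingFrame`): the
compatibility conditions of the system reduce to the Gauss equation Δλ = -e^λ, the Codazzi part
holding identically. The linear Frobenius theorem `exists_local_solution` therefore gives local
solutions with arbitrary initial values.

The frame system is skew-symmetric. So |X|² + |Y|² + |l|² is constant for each solution, and
applying this to differences gives uniqueness on every connected open set. Skew-symmetry also makes
(Y × l, l × X, X × Y) a solution; by uniqueness a frame that starts right oriented and orthonormal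
stays so. For two surfaces, the rotation matching their frames at one point matches them everywhere,
and what remains is a translation. -/

noncomputable section

namespace PrincipalSurface

open Set Metric Filter Topology

/-! ### Linear ordinary differential equations on short intervals -/

section LinearSystems

variable {E : Type*} [NormedAddCommGroup E] [NormedSpace ℝ E]

/-- A linear differential equation is solvable on every interval that is short compared with the
norm of its coefficient. -/
theorem exists_linear_ode_solution [CompleteSpace E] {B : ℝ → E →L[ℝ] E} {t₀ δ K : ℝ}
    (hδ : 0 < δ) (hB : ContinuousOn B (Icc (t₀ - δ) (t₀ + δ)))
    (hK : ∀ t ∈ Icc (t₀ - δ) (t₀ + δ), ‖B t‖ ≤ K) (hKδ : K * δ ≤ 1 / 2) (c : E) :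
    ∃ f : ℝ → E, f t₀ = c ∧ ∀ t ∈ Icc (t₀ - δ) (t₀ + δ),
      HasDerivWithinAt f (B t (f t)) (Icc (t₀ - δ) (t₀ + δ)) t := by
  have ht₀ : t₀ ∈ Icc (t₀ - δ) (t₀ + δ) := ⟨by linarith, by linarith⟩
  have hK0 : 0 ≤ K := (norm_nonneg _).trans (hK t₀ ht₀)
  -- On the ball of radius ‖c‖ about c one has ‖x‖ ≤ 2‖c‖, so the speed is at most 2K‖c‖; since Kδ ≤
  -- 1/2, a solution cannot leave this ball within time δ.
  have hPL : IsPicardLindelof (fun t x => B t x) (⟨t₀, ht₀⟩ : Icc (t₀ - δ) (t₀ + δ)) c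
      ‖c‖₊ 0 (2 * K.toNNReal * ‖c‖₊) K.toNNReal := by
    refine ⟨fun t ht => ?_, fun x _ => hB.clm_apply continuousOn_const, fun t ht x hx => ?_, ?_⟩
    · refine ((B t).lipschitz.weaken ?_).lipschitzOnWith
      rw [← NNReal.coe_le_coe, Real.coe_toNNReal _ hK0]
      exact hK t ht
    · have hx' : ‖x‖ ≤ 2 * ‖c‖ := by
        have h1 : ‖x - c‖ ≤ ‖c‖ := by simpa [dist_eq_norm] using hx
        have h2 := norm_add_le (x - c) c
        rw [sub_add_cancel] at h2
        linarith
      calc ‖B t x‖ ≤ ‖B t‖ * ‖x‖ := (B t).le_opNorm x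
        _ ≤ K * (2 * ‖c‖) := mul_le_mul (hK t ht) hx' (norm_nonneg _) hK0
        _ = _ := by push_cast; rw [Real.coe_toNNReal _ hK0]; ring
    · have : max (t₀ + δ - t₀) (t₀ - (t₀ - δ)) = δ := by
        rw [add_sub_cancel_left, sub_sub_cancel, max_self]
      simp only [this]
      push_cast
      rw [Real.coe_toNNReal _ hK0, sub_zero]
      nlinarith [norm_nonneg c]
  exact hPL.exists_eq_forall_mem_Icc_hasDerivWithinAt₀

/-- An a priori bound for an inhomogeneous linear differential equation on a short interval. -/
theorem norm_le_of_linear_ode {B : ℝ → E →L[ℝ] E} {t₀ δ K ε : ℝ} (hδ : 0 < δ)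
    (hK : ∀ t ∈ Icc (t₀ - δ) (t₀ + δ), ‖B t‖ ≤ K) (hKδ : K * δ ≤ 1 / 2) {f r : ℝ → E}
    (hf : ∀ t ∈ Icc (t₀ - δ) (t₀ + δ),
      HasDerivWithinAt f (B t (f t) + r t) (Icc (t₀ - δ) (t₀ + δ)) t)
    (hr : ∀ t ∈ Icc (t₀ - δ) (t₀ + δ), ‖r t‖ ≤ ε) {t : ℝ} (ht : t ∈ Icc (t₀ - δ) (t₀ + δ)) :
    ‖f t‖ ≤ 2 * (‖f t₀‖ + ε * δ) := by
  have ht₀ : t₀ ∈ Icc (t₀ - δ) (t₀ + δ) := ⟨by linarith, by linarith⟩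
  have hK0 : 0 ≤ K := (norm_nonneg _).trans (hK t₀ ht₀)
  have hε : 0 ≤ ε := (norm_nonneg _).trans (hr t₀ ht₀)
  have hcont : ContinuousOn f (Icc (t₀ - δ) (t₀ + δ)) := fun s hs => (hf s hs).continuousWithinAt
  -- At a maximum m of ‖f‖ the mean value inequality gives ‖f m‖ ≤ ‖f t₀‖ + (K‖f m‖ + ε)δ, and Kδ ≤
  -- 1/2 lets the left side absorb the term in ‖f m‖. This replaces Gronwall's inequality.
  obtain ⟨m, hm, hmax⟩ := isCompact_Icc.exists_isMaxOn ⟨t₀, ht₀⟩ hcont.norm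
  have hle : ∀ s ∈ Icc (t₀ - δ) (t₀ + δ), ‖f s‖ ≤ ‖f m‖ := fun s hs => hmax hs
  have hbound : ∀ s ∈ Icc (t₀ - δ) (t₀ + δ), ‖B s (f s) + r s‖ ≤ K * ‖f m‖ + ε := fun s hs =>
    (norm_add_le _ _).trans (add_le_add (((B s).le_opNorm _).trans
      (mul_le_mul (hK s hs) (hle s hs) (norm_nonneg _) hK0)) (hr s hs))
  have h1 := (convex_Icc (t₀ - δ) (t₀ + δ)).norm_image_sub_le_of_norm_hasDerivWithin_le hf
    hbound ht₀ hm
  have h2 : ‖m - t₀‖ ≤ δ := by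
    rw [Real.norm_eq_abs, abs_le]; constructor <;> linarith [hm.1, hm.2]
  have h3 : ‖f m‖ ≤ ‖f t₀‖ + ‖f m - f t₀‖ := by
    simpa using norm_add_le (f t₀) (f m - f t₀)
  have h4 : (K * ‖f m‖ + ε) * ‖m - t₀‖ ≤ (K * ‖f m‖ + ε) * δ :=
    mul_le_mul_of_nonneg_left h2 (by positivity)
  have h5 := hle t ht
  nlinarith [norm_nonneg (f m)]

end LinearSystems

/-! ### The Frobenius theorem for linear systems in two variables -/

section LinearSystems

variable {E : Type*} [NormedAddCommGroup E] [NormedSpace ℝ E]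

/-- The restriction of a differentiable function to a `v`-line. -/
theorem hasDerivAt_comp_mk_left {V : Type*} [NormedAddCommGroup V] [NormedSpace ℝ V]
    {f : ℝ × ℝ → V} {u v : ℝ} (hf : DifferentiableAt ℝ f (u, v)) :
    HasDerivAt (fun t => f (u, t)) (dv f (u, v)) v :=
  hf.hasFDerivAt.comp_hasDerivAt v ((hasDerivAt_const v u).prodMk (hasDerivAt_id v))

/-- A remainder estimate for the expansion of a `C¹` function along the `u`-lines that is uniform
over a compact convex set. -/
theorem exists_norm_sub_sub_smul_du_le {V : Type*} [NormedAddCommGroup V] [NormedSpace ℝ V]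
    {f : ℝ × ℝ → V} {S : Set (ℝ × ℝ)} (hS : IsCompact S) (hSc : Convex ℝ S)
    (hf : ∀ p ∈ S, DifferentiableAt ℝ f p) (hf' : ContinuousOn (fderiv ℝ f) S) {ε : ℝ}
    (hε : 0 < ε) :
    ∃ η > 0, ∀ u u' v : ℝ, (u, v) ∈ S → (u', v) ∈ S → |u' - u| < η →
      ‖f (u', v) - f (u, v) - (u' - u) • du f (u, v)‖ ≤ ε * |u' - u| := by
  obtain ⟨η, hη, h⟩ := Metric.uniformContinuousOn_iff.1
    (hS.uniformContinuousOn_of_continuous hf') ε hε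
  refine ⟨η, hη, fun u u' v hu hu' hlt => ?_⟩
  have hd : (u', v) - (u, v) = (u' - u) • ((1 : ℝ), (0 : ℝ)) := by simp
  have hn : ‖(u', v) - (u, v)‖ = |u' - u| := by rw [hd, norm_smul]; simp
  -- On the convex set S ∩ ball the derivative stays within ε of its value at (u, v), with η
  -- independent of the point by uniform continuity.
  have := Convex.norm_image_sub_le_of_norm_fderiv_le' (𝕜 := ℝ) (f := f) (φ := fderiv ℝ f (u, v))
    (s := S ∩ ball (u, v) η) (C := ε) (x := (u, v)) (y := (u', v)) (fun q hq => hf q hq.1)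
    (fun q hq => by
      have := h q hq.1 (u, v) hu hq.2
      rw [dist_eq_norm] at this
      exact this.le)
    (hSc.inter (convex_ball _ _)) ⟨hu, mem_ball_self hη⟩
    ⟨hu', by rw [mem_ball, dist_eq_norm, hn]; exact hlt⟩
  rwa [hn, hd, map_smul] at this

/-- **Frobenius theorem** for linear systems `f_u = A f`, `f_v = B f` in two variables. -/
theorem exists_local_solution [CompleteSpace E] {D : Set (ℝ × ℝ)} (hD : IsOpen D)
    {A B : ℝ × ℝ → E →L[ℝ] E} (hA : ContDiffOn ℝ 1 A D) (hB : ContDiffOn ℝ 1 B D)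
    (hint : ∀ p ∈ D, ∀ w, dv A p w + A p (B p w) = du B p w + B p (A p w))
    {p : ℝ × ℝ} (hp : p ∈ D) (f₀ : E) :
    ∃ r > 0, ball p r ⊆ D ∧ ∃ f : ℝ × ℝ → E, f p = f₀ ∧ ∀ q ∈ ball p r,
      DifferentiableAt ℝ f q ∧ du f q = A q (f q) ∧ dv f q = B q (f q) := by
  obtain ⟨δ₀, hδ₀, hsub₀⟩ := nhds_basis_closedBall.mem_iff.1 (hD.mem_nhds hp)
  have hcpt : IsCompact (closedBall p δ₀) := isCompact_closedBall p δ₀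
  have hB'₀ : ContinuousOn (fderiv ℝ B) D := hB.continuousOn_fderiv_of_isOpen hD le_rfl
  obtain ⟨KA, hKA⟩ := hcpt.exists_bound_of_continuousOn (hA.continuousOn.mono hsub₀)
  obtain ⟨KB, hKB⟩ := hcpt.exists_bound_of_continuousOn (hB.continuousOn.mono hsub₀)
  obtain ⟨K₁, hK₁⟩ := hcpt.exists_bound_of_continuousOn (f := fderiv ℝ B) (hB'₀.mono hsub₀)
  have hpm : p ∈ closedBall p δ₀ := mem_closedBall_self hδ₀.le
  set K := max KA KB with hKdef
  have hK0 : 0 ≤ K := ((norm_nonneg _).trans (hKA p hpm)).trans (le_max_left _ _)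
  have hK₁0 : 0 ≤ K₁ := (norm_nonneg _).trans (hK₁ p hpm)
  obtain ⟨δ, hδ, hδle, hKδ⟩ : ∃ δ > 0, δ ≤ δ₀ ∧ K * δ ≤ 1 / 2 := by
    refine ⟨min δ₀ (1 / (2 * (K + 1))), by positivity, min_le_left _ _, ?_⟩
    calc K * min δ₀ (1 / (2 * (K + 1))) ≤ K * (1 / (2 * (K + 1))) :=
          mul_le_mul_of_nonneg_left (min_le_right _ _) hK0
      _ ≤ 1 / 2 := by
          rw [mul_one_div, div_le_div_iff₀ (by positivity) (by positivity)]; linarith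
  obtain ⟨u₀, v₀⟩ := p
  set I := Icc (u₀ - δ) (u₀ + δ) with hI
  set J := Icc (v₀ - δ) (v₀ + δ) with hJ
  -- The norm on ℝ × ℝ is the maximum norm, so balls are squares.
  have hbox : closedBall (u₀, v₀) δ = I ×ˢ J := by
    rw [← closedBall_prod_same, Real.closedBall_eq_Icc, Real.closedBall_eq_Icc]
  have hS₀ : I ×ˢ J ⊆ closedBall (u₀, v₀) δ₀ := hbox ▸ closedBall_subset_closedBall hδle
  have hSD : I ×ˢ J ⊆ D := hS₀.trans hsub₀
  have hu₀ : u₀ ∈ I := ⟨by linarith, by linarith⟩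
  have hv₀ : v₀ ∈ J := ⟨by linarith, by linarith⟩
  have hnA : ∀ q ∈ I ×ˢ J, ‖A q‖ ≤ K := fun q hq => (hKA q (hS₀ hq)).trans (le_max_left _ _)
  have hnB : ∀ q ∈ I ×ˢ J, ‖B q‖ ≤ K := fun q hq => (hKB q (hS₀ hq)).trans (le_max_right _ _)
  have hnB' : ∀ q ∈ I ×ˢ J, ‖fderiv ℝ B q‖ ≤ K₁ := fun q hq => hK₁ q (hS₀ hq)
  have hdA : ∀ q ∈ I ×ˢ J, DifferentiableAt ℝ A q := fun q hq =>
    (hA.contDiffAt (hD.mem_nhds (hSD hq))).differentiableAt one_ne_zero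
  have hdB : ∀ q ∈ I ×ˢ J, DifferentiableAt ℝ B q := fun q hq =>
    (hB.contDiffAt (hD.mem_nhds (hSD hq))).differentiableAt one_ne_zero
  have hScpt : IsCompact (I ×ˢ J) := isCompact_Icc.prod isCompact_Icc
  have hSconv : Convex ℝ (I ×ˢ J) := (convex_Icc _ _).prod (convex_Icc _ _)
  -- Candidate solution: integrate f_u = A f along the line v = v₀ to get P, then f_v = B f along
  -- each v-line with initial value P u. Only f_u = A f off the line v = v₀ and joint
  -- differentiability remain to be shown.
  obtain ⟨P, hP₀, hP⟩ := exists_linear_ode_solution (B := fun t => A (t, v₀)) hδ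
    ((hA.continuousOn.mono hSD).comp (by fun_prop) fun t ht => mk_mem_prod ht hv₀)
    (fun t ht => hnA _ ⟨ht, hv₀⟩) hKδ f₀
  have hFex : ∀ u, ∃ f : ℝ → E, u ∈ I → f v₀ = P u ∧
      ∀ t ∈ J, HasDerivWithinAt f (B (u, t) (f t)) J t := fun u => by
    by_cases hu : u ∈ I
    · obtain ⟨f, hf⟩ := exists_linear_ode_solution (B := fun t => B (u, t)) hδ
        ((hB.continuousOn.mono hSD).comp (by fun_prop) fun t ht => mk_mem_prod hu ht)
        (fun t ht => hnB _ ⟨hu, ht⟩) hKδ (P u)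
      exact ⟨f, fun _ => hf⟩
    · exact ⟨0, fun h => absurd h hu⟩
  choose F hF using hFex
  have hPb : ∀ u ∈ I, ‖P u‖ ≤ 2 * ‖f₀‖ := fun u hu => by
    have := norm_le_of_linear_ode (B := fun t => A (t, v₀)) (r := 0) (ε := 0) hδ
      (fun t ht => hnA _ ⟨ht, hv₀⟩) hKδ (f := P) (by simpa using hP) (by simp) hu
    simpa [hP₀] using this
  have hFb : ∀ u ∈ I, ∀ v ∈ J, ‖F u v‖ ≤ 4 * ‖f₀‖ := fun u hu v hv => by
    have := norm_le_of_linear_ode (B := fun t => B (u, t)) (r := 0) (ε := 0) hδ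
      (fun t ht => hnB _ ⟨hu, ht⟩) hKδ (f := F u) (fun t ht => by simpa using (hF u hu).2 t ht) (by simp) hv
    rw [(hF u hu).1] at this
    linarith [hPb u hu]
  have hPl : ∀ u ∈ I, ∀ u' ∈ I, ‖P u' - P u‖ ≤ K * (2 * ‖f₀‖) * |u' - u| :=
    fun u hu u' hu' => (convex_Icc _ _).norm_image_sub_le_of_norm_hasDerivWithin_le hP
      (fun t ht => ((A (t, v₀)).le_opNorm _).trans
        (mul_le_mul (hnA _ ⟨ht, hv₀⟩) (hPb t ht) (norm_nonneg _) hK0)) hu hu'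
  have hBl : ∀ u ∈ I, ∀ u' ∈ I, ∀ v ∈ J, ‖B (u', v) - B (u, v)‖ ≤ K₁ * |u' - u| :=
    fun u hu u' hu' v hv => by
      have := hSconv.norm_image_sub_le_of_norm_fderiv_le hdB hnB' (mk_mem_prod hu hv)
        (mk_mem_prod hu' hv)
      simpa [Prod.norm_def] using this
  obtain ⟨C, hC0, hC⟩ : ∃ C ≥ 0, ∀ u ∈ I, ∀ u' ∈ I, ∀ v ∈ J,
      ‖F u' v - F u v‖ ≤ C * |u' - u| := by
    refine ⟨2 * (K * (2 * ‖f₀‖) + K₁ * (4 * ‖f₀‖) * δ), by positivity,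
      fun u hu u' hu' v hv => ?_⟩
    -- The difference of two neighbouring v-line solutions solves the equation at u with the
    -- inhomogeneity (B(u', t) - B(u, t)) F(u', t).
    have := norm_le_of_linear_ode (B := fun t => B (u, t)) (f := fun t => F u' t - F u t)
      (r := fun t => (B (u', t) - B (u, t)) (F u' t)) (ε := K₁ * |u' - u| * (4 * ‖f₀‖)) hδ
      (fun t ht => hnB _ ⟨hu, ht⟩) hKδ (fun t ht => ?_) (fun t ht => ?_) hv
    · rw [(hF u hu).1, (hF u' hu').1] at this
      linarith [hPl u hu u' hu']
    · refine (((hF u' hu').2 t ht).sub ((hF u hu).2 t ht)).congr_deriv ?_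
      simp
    · exact ((B (u', t) - B (u, t)).le_opNorm _).trans
        (mul_le_mul (hBl u hu u' hu' t ht) (hFb u' hu' t ht) (norm_nonneg _) (by positivity))
  have hkey : ∀ u ∈ I, ∀ v ∈ J,
      HasDerivWithinAt (fun s => F s v) (A (u, v) (F u v)) I u := by
    intro u hu v hv
    rw [hasDerivWithinAt_iff_isLittleO, Asymptotics.isLittleO_iff]
    intro c hc
    -- M collects the constants of the a priori bound below: 1 from the initial error on v = v₀, and
    -- 4‖f₀‖ and K₁C from the two parts of the inhomogeneity.
    set M := 2 * (1 + (4 * ‖f₀‖ + K₁ * C) * δ) with hM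
    have hM0 : 0 < M := by positivity
    set ε := c / M with hε
    have hε0 : 0 < ε := by positivity
    obtain ⟨η, hη, hrem⟩ := exists_norm_sub_sub_smul_du_le hScpt hSconv hdB (hB'₀.mono hSD) hε0
    have hPε : ∀ᶠ u' in 𝓝[I] u, ‖P u' - P u - (u' - u) • A (u, v₀) (P u)‖ ≤ ε * ‖u' - u‖ :=
      Asymptotics.isLittleO_iff.1 (hasDerivWithinAt_iff_isLittleO.1 (hP u hu)) hε0
    have hnear : ∀ᶠ u' in 𝓝[I] u, |u' - u| < min η ε :=
      mem_nhdsWithin_of_mem_nhds (ball_mem_nhds u (lt_min hη hε0))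
    filter_upwards [hPε, hnear, self_mem_nhdsWithin] with u' h1 h2 hu'
    -- The error of the first-order expansion of F in u, with A F as proposed derivative, solves a
    -- linear equation in t. Its initial value and its inhomogeneity are small compared with |u' -
    -- u|, hence so is the error for every t in J.
    have := norm_le_of_linear_ode (B := fun t => B (u, t))
      (f := fun t => F u' t - F u t - (u' - u) • A (u, t) (F u t))
      (r := fun t => (B (u', t) - B (u, t) - (u' - u) • du B (u, t)) (F u' t) +
        (u' - u) • du B (u, t) (F u' t - F u t))
      (ε := ε * |u' - u| * (4 * ‖f₀‖) + |u' - u| * (K₁ * (C * ε))) hδ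
      (fun t ht => hnB _ ⟨hu, ht⟩) hKδ (fun t ht => ?_) (fun t ht => ?_) hv
    · simp only [(hF u hu).1, (hF u' hu').1] at this
      refine this.trans ?_
      calc 2 * (‖P u' - P u - (u' - u) • A (u, v₀) (P u)‖ +
            (ε * |u' - u| * (4 * ‖f₀‖) + |u' - u| * (K₁ * (C * ε))) * δ)
          ≤ 2 * (ε * |u' - u| +
            (ε * |u' - u| * (4 * ‖f₀‖) + |u' - u| * (K₁ * (C * ε))) * δ) := by gcongr; exact h1
        _ = ε * M * |u' - u| := by rw [hM]; ring
        _ = c * ‖u' - u‖ := by rw [hε, div_mul_cancel₀ _ hM0.ne', Real.norm_eq_abs]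
    · have hAd : HasDerivWithinAt (fun t => A (u, t)) (dv A (u, t)) J t :=
        (hasDerivAt_comp_mk_left (hdA (u, t) ⟨hu, ht⟩)).hasDerivWithinAt
      have hd := (((hF u' hu').2 t ht).sub ((hF u hu).2 t ht)).sub
        ((hAd.clm_apply ((hF u hu).2 t ht)).const_smul (u' - u))
      refine hd.congr_deriv ?_
      -- Integrability turns A_v + AB into B_u + BA; then BA applied to F joins the homogeneous
      -- part, and only the remainder of B and B_u applied to F(u') - F(u) are left.
      rw [hint (u, t) (hSD ⟨hu, ht⟩) (F u t)]
      simp only [map_sub, map_smul, sub_apply, smul_apply]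
      module
    · have hdu : ‖du B (u, t)‖ ≤ K₁ := by
        refine ((fderiv ℝ B (u, t)).le_opNorm _).trans ?_
        simpa using hnB' (u, t) ⟨hu, ht⟩
      refine (norm_add_le _ _).trans (add_le_add ?_ ?_)
      · exact (ContinuousLinearMap.le_opNorm _ _).trans (mul_le_mul
          (hrem u u' t ⟨hu, ht⟩ ⟨hu', ht⟩ (h2.trans_le (min_le_left _ _)))
          (hFb u' hu' t ht) (norm_nonneg _) (by positivity))
      · rw [norm_smul, Real.norm_eq_abs]
        have h3 : ‖F u' t - F u t‖ ≤ C * ε := (hC u hu u' hu' t ht).trans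
          (mul_le_mul_of_nonneg_left (h2.le.trans (min_le_right _ _)) hC0)
        exact mul_le_mul_of_nonneg_left ((ContinuousLinearMap.le_opNorm _ _).trans
          (mul_le_mul hdu h3 (norm_nonneg _) hK₁0)) (abs_nonneg _)
  have hnhds : ∀ q ∈ ball (u₀, v₀) δ, I ×ˢ J ∈ 𝓝 q := fun q hq =>
    mem_of_superset (isOpen_ball.mem_nhds hq) (hbox ▸ ball_subset_closedBall)
  have hcont : ContinuousOn (fun q : ℝ × ℝ => F q.1 q.2) (I ×ˢ J) := by
    refine continuousOn_prod_of_continuousOn_lipschitzOnWith _ C.toNNReal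
      (fun u hu t ht => ((hF u hu).2 t ht).continuousWithinAt) (fun v hv => ?_)
    refine LipschitzOnWith.of_dist_le_mul fun u' hu' u hu => ?_
    rw [dist_eq_norm, Real.dist_eq, Real.coe_toNNReal _ hC0]
    exact hC u hu u' hu' v hv
  refine ⟨δ, hδ, (ball_subset_closedBall.trans hbox.subset).trans hSD, fun q => F q.1 q.2,
    by simp [(hF u₀ hu₀).1, hP₀], fun q hq => ?_⟩
  have hcA : ContinuousAt (fun z : ℝ × ℝ => A z (F z.1 z.2)) q :=
    ((hA.continuousOn.mono hSD).clm_apply hcont).continuousAt (hnhds q hq)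
  have hcB : ContinuousAt (fun z : ℝ × ℝ => B z (F z.1 z.2)) q :=
    ((hB.continuousOn.mono hSD).clm_apply hcont).continuousAt (hnhds q hq)
  have hev : ∀ᶠ z in 𝓝 q, I ×ˢ J ∈ 𝓝 z := by
    filter_upwards [isOpen_ball.mem_nhds hq] with z hz using hnhds z hz
  -- Both partial derivatives exist near q and are continuous at q, since F is jointly continuous;
  -- hence F is differentiable there.
  have hstrict := (hasStrictFDerivAt_uncurry_coprod (𝕜 := ℝ) (u := q) (f := F)
    (f₁ := fun a b => ContinuousLinearMap.toSpanSingleton ℝ (A (a, b) (F a b)))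
    (f₂ := fun a b => ContinuousLinearMap.toSpanSingleton ℝ (B (a, b) (F a b)))
    (by
      filter_upwards [hev] with z hz
      obtain ⟨hz1, hz2⟩ := mem_of_mem_nhds hz
      have hI' : I ∈ 𝓝 z.1 := (prod_mem_nhds_iff.1 hz).1
      exact ((hkey z.1 hz1 z.2 hz2).hasDerivAt hI').hasFDerivAt)
    (by
      filter_upwards [hev] with z hz
      obtain ⟨hz1, hz2⟩ := mem_of_mem_nhds hz
      have hJ' : J ∈ 𝓝 z.2 := (prod_mem_nhds_iff.1 hz).2
      exact (((hF z.1 hz1).2 z.2 hz2).hasDerivAt hJ').hasFDerivAt)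
    ((ContinuousLinearMap.toSpanSingletonCLE (𝕜 := ℝ) (E := E)).continuous.continuousAt.comp hcA)
    ((ContinuousLinearMap.toSpanSingletonCLE (𝕜 := ℝ) (E := E)).continuous.continuousAt.comp
      hcB)).hasFDerivAt
  have hfd : fderiv ℝ (fun q : ℝ × ℝ => F q.1 q.2) q = _ := hstrict.fderiv
  refine ⟨hstrict.differentiableAt, ?_, ?_⟩
  · rw [du, hfd]; simp [Function.HasUncurry.uncurry]
  · rw [dv, hfd]; simp [Function.HasUncurry.uncurry]

end LinearSystems

/-! ### Algebra of the vector product -/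

section VectorProduct

theorem inner_eq_sum (a b : E3) : inner ℝ a b = a 0 * b 0 + a 1 * b 1 + a 2 * b 2 := by
  simp [PiLp.inner_apply, Fin.sum_univ_three]; ring

theorem cross_zero (a b : E3) : cross a b 0 = a 1 * b 2 - a 2 * b 1 := by
  simp [cross, cross_apply]

theorem cross_one (a b : E3) : cross a b 1 = a 2 * b 0 - a 0 * b 2 := by
  simp [cross, cross_apply]

theorem cross_two (a b : E3) : cross a b 2 = a 0 * b 1 - a 1 * b 0 := by
  simp [cross, cross_apply]

theorem E3_ext {a b : E3} (h0 : a 0 = b 0) (h1 : a 1 = b 1) (h2 : a 2 = b 2) : a = b := by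
  ext i; fin_cases i <;> assumption

theorem cross_add_left (a a' b : E3) : cross (a + a') b = cross a b + cross a' b := by
  apply E3_ext <;> simp only [PiLp.add_apply, cross_zero, cross_one, cross_two] <;> ring

theorem cross_add_right (a b b' : E3) : cross a (b + b') = cross a b + cross a b' := by
  apply E3_ext <;> simp only [PiLp.add_apply, cross_zero, cross_one, cross_two] <;> ring

theorem cross_smul_left (r : ℝ) (a b : E3) : cross (r • a) b = r • cross a b := by
  apply E3_ext <;>
    simp only [PiLp.smul_apply, smul_eq_mul, cross_zero, cross_one, cross_two] <;> ring

theorem cross_smul_right (r : ℝ) (a b : E3) : cross a (r • b) = r • cross a b := by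
  apply E3_ext <;>
    simp only [PiLp.smul_apply, smul_eq_mul, cross_zero, cross_one, cross_two] <;> ring

theorem cross_self (a : E3) : cross a a = 0 := by
  apply E3_ext <;> simp only [PiLp.zero_apply, cross_zero, cross_one, cross_two] <;> ring

theorem cross_anticomm (a b : E3) : cross a b = -cross b a := by
  apply E3_ext <;> simp only [PiLp.neg_apply, cross_zero, cross_one, cross_two] <;> ring

theorem inner_cross_left (a b : E3) : inner ℝ a (cross a b) = 0 := by
  simp only [inner_eq_sum, cross_zero, cross_one, cross_two]; ring

theorem inner_cross_right (a b : E3) : inner ℝ b (cross a b) = 0 := by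
  simp only [inner_eq_sum, cross_zero, cross_one, cross_two]; ring

theorem inner_cross_self (a b : E3) : inner ℝ (cross a b) (cross a b) =
    inner ℝ a a * inner ℝ b b - inner ℝ a b ^ 2 := by
  simp only [inner_eq_sum, cross_zero, cross_one, cross_two]; ring

theorem cross_cross_left (a b : E3) :
    cross (cross a b) a = (inner ℝ a a : ℝ) • b - (inner ℝ a b : ℝ) • a := by
  apply E3_ext <;>
    simp only [inner_eq_sum, PiLp.sub_apply, PiLp.smul_apply, smul_eq_mul, cross_zero, cross_one,
      cross_two] <;> ring

theorem cross_cross_right (a b : E3) :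
    cross (cross a b) b = (inner ℝ a b : ℝ) • b - (inner ℝ b b : ℝ) • a := by
  apply E3_ext <;>
    simp only [inner_eq_sum, PiLp.sub_apply, PiLp.smul_apply, smul_eq_mul, cross_zero, cross_one,
      cross_two] <;> ring

/-- The vector product as a continuous bilinear map. -/
def crossCLM : E3 →L[ℝ] E3 →L[ℝ] E3 :=
  (LinearMap.mk₂ ℝ cross cross_add_left cross_smul_left cross_add_right
    cross_smul_right).toContinuousBilinearMap

/-- A vector orthogonal to three pairwise orthogonal nonzero vectors vanishes. -/
theorem eq_zero_of_inner_eq_zero {a b c w : E3} (ha : a ≠ 0) (hb : b ≠ 0) (hc : c ≠ 0)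
    (hab : inner ℝ a b = 0) (hac : inner ℝ a c = 0) (hbc : inner ℝ b c = 0)
    (h1 : inner ℝ w a = 0) (h2 : inner ℝ w b = 0) (h3 : inner ℝ w c = 0) : w = 0 := by
  have hli : LinearIndependent ℝ ![a, b, c] := by
    refine linearIndependent_of_ne_zero_of_inner_eq_zero (𝕜 := ℝ) (fun i => ?_)
      fun i j hij => ?_
    · fin_cases i <;> assumption
    · fin_cases i <;> fin_cases j <;> simp_all [real_inner_comm]
  have hspan := hli.span_eq_top_of_card_eq_finrank (by simp)
  have hw : w ∈ Submodule.span ℝ (range ![a, b, c]) := hspan ▸ Submodule.mem_top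
  have : ∀ z ∈ Submodule.span ℝ (range ![a, b, c]), inner ℝ w z = 0 := fun z hz => by
    induction hz using Submodule.span_induction with
    | mem z hz =>
      obtain ⟨i, rfl⟩ := hz
      fin_cases i <;> assumption
    | zero => simp
    | add y z _ _ hy hz => rw [inner_add_right, hy, hz, add_zero]
    | smul r z _ hz => rw [inner_smul_right, hz, mul_zero]
  exact inner_self_eq_zero.1 (this w hw)

end VectorProduct

/-! ### Calculus of the partial derivatives -/

section PartialDerivatives

variable {V W : Type*} [NormedAddCommGroup V] [NormedSpace ℝ V] [NormedAddCommGroup W]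
  [NormedSpace ℝ W] {p : ℝ × ℝ}

theorem fderiv_eq_zero {f : ℝ × ℝ → V} (hu : du f p = 0) (hv : dv f p = 0) :
    fderiv ℝ f p = 0 := by
  ext
  · simpa [du] using hu
  · simpa [dv] using hv

theorem du_congr {f g : ℝ × ℝ → V} (h : f =ᶠ[𝓝 p] g) : du f p = du g p := by
  rw [du, du, h.fderiv_eq]

theorem dv_congr {f g : ℝ × ℝ → V} (h : f =ᶠ[𝓝 p] g) : dv f p = dv g p := by
  rw [dv, dv, h.fderiv_eq]

theorem du_congr_of_isOpen {D : Set (ℝ × ℝ)} (hD : IsOpen D) (hp : p ∈ D) {f g : ℝ × ℝ → V}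
    (h : ∀ q ∈ D, f q = g q) : du f p = du g p :=
  du_congr (eventually_of_mem (hD.mem_nhds hp) h)

theorem dv_congr_of_isOpen {D : Set (ℝ × ℝ)} (hD : IsOpen D) (hp : p ∈ D) {f g : ℝ × ℝ → V}
    (h : ∀ q ∈ D, f q = g q) : dv f p = dv g p :=
  dv_congr (eventually_of_mem (hD.mem_nhds hp) h)

theorem du_const (c : V) : du (fun _ => c) p = 0 := by simp [du]

theorem dv_const (c : V) : dv (fun _ => c) p = 0 := by simp [dv]

theorem du_add {f g : ℝ × ℝ → V} (hf : DifferentiableAt ℝ f p) (hg : DifferentiableAt ℝ g p) :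
    du (fun q => f q + g q) p = du f p + du g p := by
  simp [du, fderiv_fun_add hf hg]

theorem dv_add {f g : ℝ × ℝ → V} (hf : DifferentiableAt ℝ f p) (hg : DifferentiableAt ℝ g p) :
    dv (fun q => f q + g q) p = dv f p + dv g p := by
  simp [dv, fderiv_fun_add hf hg]

theorem du_sub {f g : ℝ × ℝ → V} (hf : DifferentiableAt ℝ f p) (hg : DifferentiableAt ℝ g p) :
    du (fun q => f q - g q) p = du f p - du g p := by
  simp [du, fderiv_fun_sub hf hg]

theorem dv_sub {f g : ℝ × ℝ → V} (hf : DifferentiableAt ℝ f p) (hg : DifferentiableAt ℝ g p) :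
    dv (fun q => f q - g q) p = dv f p - dv g p := by
  simp [dv, fderiv_fun_sub hf hg]

theorem du_smul {s : ℝ × ℝ → ℝ} {f : ℝ × ℝ → V} (hs : DifferentiableAt ℝ s p)
    (hf : DifferentiableAt ℝ f p) :
    du (fun q => s q • f q) p = du s p • f p + s p • du f p := by
  simp [du, fderiv_fun_smul hs hf, add_comm]

theorem dv_smul {s : ℝ × ℝ → ℝ} {f : ℝ × ℝ → V} (hs : DifferentiableAt ℝ s p)
    (hf : DifferentiableAt ℝ f p) :
    dv (fun q => s q • f q) p = dv s p • f p + s p • dv f p := by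
  simp [dv, fderiv_fun_smul hs hf, add_comm]

theorem du_clm_comp (L : V →L[ℝ] W) {f : ℝ × ℝ → V} (hf : DifferentiableAt ℝ f p) :
    du (fun q => L (f q)) p = L (du f p) := by
  have := (L.hasFDerivAt.comp p hf.hasFDerivAt).fderiv
  exact congrArg (fun T : ℝ × ℝ →L[ℝ] W => T (1, 0)) this

theorem dv_clm_comp (L : V →L[ℝ] W) {f : ℝ × ℝ → V} (hf : DifferentiableAt ℝ f p) :
    dv (fun q => L (f q)) p = L (dv f p) := by
  have := (L.hasFDerivAt.comp p hf.hasFDerivAt).fderiv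
  exact congrArg (fun T : ℝ × ℝ →L[ℝ] W => T (0, 1)) this

theorem du_inner {f g : ℝ × ℝ → E3} (hf : DifferentiableAt ℝ f p)
    (hg : DifferentiableAt ℝ g p) : du (fun q => (inner ℝ (f q) (g q) : ℝ)) p =
      inner ℝ (f p) (du g p) + inner ℝ (du f p) (g p) :=
  fderiv_inner_apply ℝ hf hg _

theorem dv_inner {f g : ℝ × ℝ → E3} (hf : DifferentiableAt ℝ f p)
    (hg : DifferentiableAt ℝ g p) : dv (fun q => (inner ℝ (f q) (g q) : ℝ)) p =
      inner ℝ (f p) (dv g p) + inner ℝ (dv f p) (g p) :=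
  fderiv_inner_apply ℝ hf hg _

theorem differentiableAt_cross {f g : ℝ × ℝ → E3} (hf : DifferentiableAt ℝ f p)
    (hg : DifferentiableAt ℝ g p) : DifferentiableAt ℝ (fun q => cross (f q) (g q)) p :=
  (crossCLM.hasFDerivAt_of_bilinear hf.hasFDerivAt hg.hasFDerivAt).differentiableAt

theorem du_cross {f g : ℝ × ℝ → E3} (hf : DifferentiableAt ℝ f p)
    (hg : DifferentiableAt ℝ g p) : du (fun q => cross (f q) (g q)) p =
      cross (f p) (du g p) + cross (du f p) (g p) :=
  congrArg (fun T : ℝ × ℝ →L[ℝ] E3 => T (1, 0))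
    (crossCLM.hasFDerivAt_of_bilinear hf.hasFDerivAt hg.hasFDerivAt).fderiv

theorem dv_cross {f g : ℝ × ℝ → E3} (hf : DifferentiableAt ℝ f p)
    (hg : DifferentiableAt ℝ g p) : dv (fun q => cross (f q) (g q)) p =
      cross (f p) (dv g p) + cross (dv f p) (g p) :=
  congrArg (fun T : ℝ × ℝ →L[ℝ] E3 => T (0, 1))
    (crossCLM.hasFDerivAt_of_bilinear hf.hasFDerivAt hg.hasFDerivAt).fderiv

theorem contDiffOn_du {D : Set (ℝ × ℝ)} (hD : IsOpen D) {f : ℝ × ℝ → V} {m n : WithTop ℕ∞}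
    (hf : ContDiffOn ℝ n f D) (hmn : m + 1 ≤ n) : ContDiffOn ℝ m (du f) D :=
  (hf.fderiv_of_isOpen hD hmn).clm_apply contDiffOn_const

theorem contDiffOn_dv {D : Set (ℝ × ℝ)} (hD : IsOpen D) {f : ℝ × ℝ → V} {m n : WithTop ℕ∞}
    (hf : ContDiffOn ℝ n f D) (hmn : m + 1 ≤ n) : ContDiffOn ℝ m (dv f) D :=
  (hf.fderiv_of_isOpen hD hmn).clm_apply contDiffOn_const

/-- A function with partial derivatives of class `Cⁿ` is of class `Cⁿ⁺¹`. -/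
theorem contDiffOn_succ_of_du_dv {D : Set (ℝ × ℝ)} (hD : IsOpen D) {f : ℝ × ℝ → V} {n : ℕ∞}
    (hf : ∀ p ∈ D, DifferentiableAt ℝ f p) (hu : ContDiffOn ℝ n (du f) D)
    (hv : ContDiffOn ℝ n (dv f) D) : ContDiffOn ℝ ((n : WithTop ℕ∞) + 1) f D := by
  rw [contDiffOn_succ_iff_fderiv_of_isOpen hD]
  refine ⟨fun p hp => (hf p hp).differentiableWithinAt, by simp, ?_⟩
  rw [contDiffOn_clm_apply]
  rintro ⟨s, t⟩
  refine ((hu.const_smul s).add (hv.const_smul t)).congr fun p _ => ?_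
  have : ((s, t) : ℝ × ℝ) = s • (1, 0) + t • (0, 1) := by simp
  rw [this, map_add, map_smul, map_smul]
  rfl

/-- Schwarz's theorem. -/
theorem du_dv_comm {f : ℝ × ℝ → V} (hf : ContDiffAt ℝ 2 f p) : du (dv f) p = dv (du f) p := by
  have hd : DifferentiableAt ℝ (fderiv ℝ f) p :=
    (hf.fderiv_right (m := 1) (by norm_num)).differentiableAt one_ne_zero
  have h := hf.isSymmSndFDerivAt (by simp) (1, 0) (0, 1)
  have h1 := du_clm_comp (ContinuousLinearMap.apply ℝ V ((0 : ℝ), (1 : ℝ))) hd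
  have h2 := dv_clm_comp (ContinuousLinearMap.apply ℝ V ((1 : ℝ), (0 : ℝ))) hd
  exact h1.trans (h.trans h2.symm)

end PartialDerivatives

/-! ### The frame equations: uniqueness and preservation of orthonormality -/

section MovingFrames

/-- The common length of `x_u` and `x_v` on the surface generated by `lam`. -/
def speed (lam : ℝ × ℝ → ℝ) (p : ℝ × ℝ) : ℝ := 1 / √2 * Real.exp (-(lam p / 2))

/-- The length of the derivatives of the unit normal of the surface generated by `lam`. -/
def normalSpeed (lam : ℝ × ℝ → ℝ) (p : ℝ × ℝ) : ℝ := 1 / √2 * Real.exp (lam p / 2)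

/-- The linear partial differential equations satisfied by the principal frame `X, Y, l` of the
surface generated by `lam`. -/
structure IsMovingFrame (lam : ℝ × ℝ → ℝ) (X Y l : ℝ × ℝ → E3) (D : Set (ℝ × ℝ)) : Prop where
  diffX : ∀ p ∈ D, DifferentiableAt ℝ X p
  diffY : ∀ p ∈ D, DifferentiableAt ℝ Y p
  diffl : ∀ p ∈ D, DifferentiableAt ℝ l p
  duX : ∀ p ∈ D, du X p = (dv lam p / 2) • Y p + normalSpeed lam p • l p
  dvX : ∀ p ∈ D, dv X p = -(du lam p / 2) • Y p
  duY : ∀ p ∈ D, du Y p = -(dv lam p / 2) • X p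
  dvY : ∀ p ∈ D, dv Y p = (du lam p / 2) • X p - normalSpeed lam p • l p
  dul : ∀ p ∈ D, du l p = -normalSpeed lam p • X p
  dvl : ∀ p ∈ D, dv l p = normalSpeed lam p • Y p

/-- The vectors `a, b, c` form a right oriented orthonormal frame. -/
structure IsRightFrame (a b c : E3) : Prop where
  aa : inner ℝ a a = (1 : ℝ)
  bb : inner ℝ b b = (1 : ℝ)
  ab : inner ℝ a b = (0 : ℝ)
  eq_cross : c = cross a b

variable {lam : ℝ × ℝ → ℝ} {X Y l X' Y' l' : ℝ × ℝ → E3} {D : Set (ℝ × ℝ)} {p : ℝ × ℝ}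

theorem speed_pos : 0 < speed lam p := by unfold speed; positivity

theorem normalSpeed_pos : 0 < normalSpeed lam p := by unfold normalSpeed; positivity

/-- The exponentials cancel. This and the two identities that follow remove √2 and the exponentials
from the later computations. -/
theorem two_mul_normalSpeed_mul_speed : 2 * normalSpeed lam p * speed lam p = 1 := by
  have h : Real.exp (lam p / 2) * Real.exp (-(lam p / 2)) = 1 := by
    rw [← Real.exp_add]; simp
  have h2 : √2 * √2 = 2 := Real.mul_self_sqrt (by norm_num)
  unfold speed normalSpeed
  field_simp
  linear_combination 2 * h - h2

theorem two_mul_normalSpeed_sq : 2 * normalSpeed lam p ^ 2 = Real.exp (lam p) := by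
  have h : Real.exp (lam p / 2) * Real.exp (lam p / 2) = Real.exp (lam p) := by
    rw [← Real.exp_add]; simp
  have h2 : √2 * √2 = 2 := Real.mul_self_sqrt (by norm_num)
  unfold normalSpeed
  field_simp
  linear_combination 2 * h - Real.exp (lam p) * h2

theorem exp_mul_speed : Real.exp (lam p) * speed lam p = normalSpeed lam p := by
  rw [← two_mul_normalSpeed_sq]
  linear_combination normalSpeed lam p * two_mul_normalSpeed_mul_speed (lam := lam) (p := p)

theorem hasFDerivAt_speed (h : DifferentiableAt ℝ lam p) :
    HasFDerivAt (speed lam) ((-(speed lam p / 2)) • fderiv ℝ lam p) p := by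
  have := (((h.hasFDerivAt.mul_const (2 : ℝ)⁻¹).neg).exp).const_mul (1 / √2)
  simp only [← div_eq_mul_inv] at this
  refine this.congr_fderiv ?_
  ext <;> simp [speed] <;> ring

theorem hasFDerivAt_normalSpeed (h : DifferentiableAt ℝ lam p) :
    HasFDerivAt (normalSpeed lam) ((normalSpeed lam p / 2) • fderiv ℝ lam p) p := by
  have := ((h.hasFDerivAt.mul_const (2 : ℝ)⁻¹).exp).const_mul (1 / √2)
  simp only [← div_eq_mul_inv] at this
  refine this.congr_fderiv ?_
  ext <;> simp [normalSpeed] <;> ring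

theorem du_speed (h : DifferentiableAt ℝ lam p) :
    du (speed lam) p = -(speed lam p / 2) * du lam p := by
  rw [du, (hasFDerivAt_speed h).fderiv]; rfl

theorem dv_speed (h : DifferentiableAt ℝ lam p) :
    dv (speed lam) p = -(speed lam p / 2) * dv lam p := by
  rw [dv, (hasFDerivAt_speed h).fderiv]; rfl

theorem du_normalSpeed (h : DifferentiableAt ℝ lam p) :
    du (normalSpeed lam) p = normalSpeed lam p / 2 * du lam p := by
  rw [du, (hasFDerivAt_normalSpeed h).fderiv]; rfl

theorem dv_normalSpeed (h : DifferentiableAt ℝ lam p) :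
    dv (normalSpeed lam) p = normalSpeed lam p / 2 * dv lam p := by
  rw [dv, (hasFDerivAt_normalSpeed h).fderiv]; rfl

theorem contDiffOn_speed {n : WithTop ℕ∞} (h : ContDiffOn ℝ n lam D) :
    ContDiffOn ℝ n (speed lam) D :=
  contDiffOn_const.mul (h.div_const 2).neg.exp

theorem contDiffOn_normalSpeed {n : WithTop ℕ∞} (h : ContDiffOn ℝ n lam D) :
    ContDiffOn ℝ n (normalSpeed lam) D :=
  contDiffOn_const.mul (h.div_const 2).exp

namespace IsMovingFrame

/-- The system is linear; this reduces uniqueness to solutions vanishing at a point. -/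
theorem sub (h : IsMovingFrame lam X Y l D) (h' : IsMovingFrame lam X' Y' l' D) :
    IsMovingFrame lam (fun p => X p - X' p) (fun p => Y p - Y' p) (fun p => l p - l' p) D where
  diffX p hp := (h.diffX p hp).sub (h'.diffX p hp)
  diffY p hp := (h.diffY p hp).sub (h'.diffY p hp)
  diffl p hp := (h.diffl p hp).sub (h'.diffl p hp)
  duX p hp := by
    rw [du_sub (h.diffX p hp) (h'.diffX p hp), h.duX p hp, h'.duX p hp]; module
  dvX p hp := by
    rw [dv_sub (h.diffX p hp) (h'.diffX p hp), h.dvX p hp, h'.dvX p hp]; module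
  duY p hp := by
    rw [du_sub (h.diffY p hp) (h'.diffY p hp), h.duY p hp, h'.duY p hp]; module
  dvY p hp := by
    rw [dv_sub (h.diffY p hp) (h'.diffY p hp), h.dvY p hp, h'.dvY p hp]; module
  dul p hp := by
    rw [du_sub (h.diffl p hp) (h'.diffl p hp), h.dul p hp, h'.dul p hp]; module
  dvl p hp := by
    rw [dv_sub (h.diffl p hp) (h'.diffl p hp), h.dvl p hp, h'.dvl p hp]; module

/-- The coefficients are scalars, so they commute with a constant linear map; used to rotate one
frame onto another. -/
theorem map (h : IsMovingFrame lam X Y l D) (L : E3 →L[ℝ] E3) :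
    IsMovingFrame lam (fun p => L (X p)) (fun p => L (Y p)) (fun p => L (l p)) D where
  diffX p hp := L.differentiableAt.comp p (h.diffX p hp)
  diffY p hp := L.differentiableAt.comp p (h.diffY p hp)
  diffl p hp := L.differentiableAt.comp p (h.diffl p hp)
  duX p hp := by rw [du_clm_comp L (h.diffX p hp), h.duX p hp]; simp
  dvX p hp := by rw [dv_clm_comp L (h.diffX p hp), h.dvX p hp]; simp
  duY p hp := by rw [du_clm_comp L (h.diffY p hp), h.duY p hp]; simp
  dvY p hp := by rw [dv_clm_comp L (h.diffY p hp), h.dvY p hp]; simp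
  dul p hp := by rw [du_clm_comp L (h.diffl p hp), h.dul p hp]; simp
  dvl p hp := by rw [dv_clm_comp L (h.diffl p hp), h.dvl p hp]; simp

/-- The equations are skew-symmetric, hence compatible with the vector product. -/
theorem cross (h : IsMovingFrame lam X Y l D) :
    IsMovingFrame lam (fun p => cross (Y p) (l p)) (fun p => cross (l p) (X p))
      (fun p => PrincipalSurface.cross (X p) (Y p)) D where
  diffX p hp := differentiableAt_cross (h.diffY p hp) (h.diffl p hp)
  diffY p hp := differentiableAt_cross (h.diffl p hp) (h.diffX p hp)
  diffl p hp := differentiableAt_cross (h.diffX p hp) (h.diffY p hp)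
  duX p hp := by
    rw [du_cross (h.diffY p hp) (h.diffl p hp), h.duY p hp, h.dul p hp, cross_smul_left,
      cross_smul_right, cross_anticomm (Y p) (X p), cross_anticomm (X p) (l p)]
    module
  dvX p hp := by
    simp only [dv_cross (h.diffY p hp) (h.diffl p hp), h.dvY p hp, h.dvl p hp, sub_eq_add_neg,
      ← neg_smul, cross_add_left, cross_smul_left, cross_smul_right, cross_self,
      cross_anticomm (X p) (l p)]
    module
  duY p hp := by
    simp only [du_cross (h.diffl p hp) (h.diffX p hp), h.duX p hp, h.dul p hp, cross_add_right,
      cross_smul_left, cross_smul_right, cross_self, cross_anticomm (l p) (Y p)]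
    module
  dvY p hp := by
    simp only [dv_cross (h.diffl p hp) (h.diffX p hp), h.dvX p hp, h.dvl p hp,
      cross_smul_left, cross_smul_right, cross_anticomm (l p) (Y p), cross_anticomm (Y p) (X p)]
    module
  dul p hp := by
    simp only [du_cross (h.diffX p hp) (h.diffY p hp), h.duX p hp, h.duY p hp, cross_add_left,
      cross_smul_left, cross_smul_right, cross_self, cross_anticomm (l p) (Y p)]
    module
  dvl p hp := by
    simp only [dv_cross (h.diffX p hp) (h.diffY p hp), h.dvX p hp, h.dvY p hp, sub_eq_add_neg,
      ← neg_smul, cross_add_right, cross_smul_left, cross_smul_right, cross_self,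
      cross_anticomm (X p) (l p)]
    module

/-- The sum of the squared lengths of a solution of the frame equations is constant. -/
theorem sum_inner_self_const (h : IsMovingFrame lam X Y l D) (hD : IsOpen D)
    (hc : IsPreconnected D) {p q : ℝ × ℝ} (hp : p ∈ D) (hq : q ∈ D) :
    (inner ℝ (X p) (X p) + inner ℝ (Y p) (Y p) + inner ℝ (l p) (l p) : ℝ) =
      inner ℝ (X q) (X q) + inner ℝ (Y q) (Y q) + inner ℝ (l q) (l q) := by
  have hX : ∀ p ∈ D, DifferentiableAt ℝ (fun q => (inner ℝ (X q) (X q) : ℝ)) p :=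
    fun p hp => (h.diffX p hp).inner ℝ (h.diffX p hp)
  have hY : ∀ p ∈ D, DifferentiableAt ℝ (fun q => (inner ℝ (Y q) (Y q) : ℝ)) p :=
    fun p hp => (h.diffY p hp).inner ℝ (h.diffY p hp)
  have hl : ∀ p ∈ D, DifferentiableAt ℝ (fun q => (inner ℝ (l q) (l q) : ℝ)) p :=
    fun p hp => (h.diffl p hp).inner ℝ (h.diffl p hp)
  have hd : ∀ p ∈ D, DifferentiableAt ℝ (fun q =>
      (inner ℝ (X q) (X q) + inner ℝ (Y q) (Y q) + inner ℝ (l q) (l q) : ℝ)) p :=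
    fun p hp => ((hX p hp).add (hY p hp)).add (hl p hp)
  refine hD.is_const_of_fderiv_eq_zero (𝕜 := ℝ) hc
    (fun p hp => (hd p hp).differentiableWithinAt) (fun p hp => ?_) hp hq
  have h1 := real_inner_comm (X p) (Y p)
  have h2 := real_inner_comm (X p) (l p)
  have h3 := real_inner_comm (Y p) (l p)
  -- By skew-symmetry the mixed inner products cancel in pairs.
  refine fderiv_eq_zero ?_ ?_
  · rw [du_add ((hX p hp).fun_add (hY p hp)) (hl p hp), du_add (hX p hp) (hY p hp),
      du_inner (h.diffX p hp) (h.diffX p hp), du_inner (h.diffY p hp) (h.diffY p hp),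
      du_inner (h.diffl p hp) (h.diffl p hp), h.duX p hp, h.duY p hp, h.dul p hp]
    simp only [inner_add_left, inner_add_right, real_inner_smul_left, real_inner_smul_right,
      h1, h2]
    ring
  · rw [dv_add ((hX p hp).fun_add (hY p hp)) (hl p hp), dv_add (hX p hp) (hY p hp),
      dv_inner (h.diffX p hp) (h.diffX p hp), dv_inner (h.diffY p hp) (h.diffY p hp),
      dv_inner (h.diffl p hp) (h.diffl p hp), h.dvX p hp, h.dvY p hp, h.dvl p hp]
    simp only [inner_sub_left, inner_sub_right, real_inner_smul_left, real_inner_smul_right,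
      h1, h3]
    ring

/-- Uniqueness for the frame equations. -/
theorem eq_of_eq (h : IsMovingFrame lam X Y l D) (h' : IsMovingFrame lam X' Y' l' D)
    (hD : IsOpen D) (hc : IsPreconnected D) {p₀ p : ℝ × ℝ} (hp₀ : p₀ ∈ D) (hp : p ∈ D)
    (hX : X p₀ = X' p₀) (hY : Y p₀ = Y' p₀) (hl : l p₀ = l' p₀) :
    X p = X' p ∧ Y p = Y' p ∧ l p = l' p := by
  -- The sum of squares of the difference is constant and vanishes at p₀.
  have := (h.sub h').sum_inner_self_const hD hc hp hp₀
  simp only [hX, hY, hl, sub_self, inner_zero_left, add_zero] at this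
  have h1 := real_inner_self_nonneg (x := X p - X' p)
  have h2 := real_inner_self_nonneg (x := Y p - Y' p)
  have h3 := real_inner_self_nonneg (x := l p - l' p)
  refine ⟨sub_eq_zero.1 (inner_self_eq_zero (𝕜 := ℝ).1 ?_),
    sub_eq_zero.1 (inner_self_eq_zero (𝕜 := ℝ).1 ?_),
    sub_eq_zero.1 (inner_self_eq_zero (𝕜 := ℝ).1 ?_)⟩ <;> linarith

/-- A solution of the frame equations stays a right oriented orthonormal frame. -/
theorem isRightFrame (h : IsMovingFrame lam X Y l D) (hD : IsOpen D) (hc : IsPreconnected D)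
    {p₀ p : ℝ × ℝ} (hp₀ : p₀ ∈ D) (hp : p ∈ D) (h₀ : IsRightFrame (X p₀) (Y p₀) (l p₀)) :
    IsRightFrame (X p) (Y p) (l p) := by
  obtain ⟨haa, hbb, hab, hcr⟩ := h₀
  -- At p₀ the frame equals (Y × l, l × X, X × Y), which solves the same system, so the two agree
  -- throughout D. This gives orientation and orthogonality everywhere; only the lengths are still
  -- open.
  have hX₀ : X p₀ = PrincipalSurface.cross (Y p₀) (l p₀) := by
    rw [cross_anticomm, hcr, cross_cross_right, hab, hbb]; simp
  have hY₀ : Y p₀ = PrincipalSurface.cross (l p₀) (X p₀) := by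
    rw [hcr, cross_cross_left, hab, haa]; simp
  obtain ⟨hX, hY, hl⟩ := h.eq_of_eq h.cross hD hc hp₀ hp hX₀ hY₀ hcr
  have hsum := h.sum_inner_self_const hD hc hp hp₀
  have hll : inner ℝ (l p₀) (l p₀) = (1 : ℝ) := by
    rw [hcr, inner_cross_self, haa, hbb, hab]; norm_num
  rw [haa, hbb, hll] at hsum
  have hab' : inner ℝ (X p) (Y p) = (0 : ℝ) := by
    rw [hX]; rw [real_inner_comm]; exact inner_cross_left _ _
  have hbl : inner ℝ (Y p) (l p) = (0 : ℝ) := by rw [hl]; exact inner_cross_right _ _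
  have hla : inner ℝ (l p) (X p) = (0 : ℝ) := by
    rw [hl, real_inner_comm]; exact inner_cross_left _ _
  -- The squared lengths a, b, c satisfy a = bc, b = ca, c = ab and a + b + c = 3. If a = 0, all
  -- three vanish, contradicting the sum; otherwise b² = 1, so b = 1, and the sum gives a = 1.
  have h1 : inner ℝ (X p) (X p) = (inner ℝ (Y p) (Y p) * inner ℝ (l p) (l p) : ℝ) := by
    conv_lhs => rw [hX, inner_cross_self, hbl]
    ring
  have h2 : inner ℝ (Y p) (Y p) = (inner ℝ (l p) (l p) * inner ℝ (X p) (X p) : ℝ) := by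
    conv_lhs => rw [hY, inner_cross_self, hla]
    ring
  have h3 : inner ℝ (l p) (l p) = (inner ℝ (X p) (X p) * inner ℝ (Y p) (Y p) : ℝ) := by
    conv_lhs => rw [hl, inner_cross_self, hab']
    ring
  have ha := real_inner_self_nonneg (x := X p)
  have hb := real_inner_self_nonneg (x := Y p)
  suffices h : (inner ℝ (X p) (X p) : ℝ) = 1 ∧ (inner ℝ (Y p) (Y p) : ℝ) = 1 from
    ⟨h.1, h.2, hab', hl⟩
  generalize (inner ℝ (X p) (X p) : ℝ) = a at *
  generalize (inner ℝ (Y p) (Y p) : ℝ) = b at *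
  generalize (inner ℝ (l p) (l p) : ℝ) = c at *
  subst h3
  have ha0 : a ≠ 0 := by
    rintro rfl
    have : b = 0 := by rw [h2]; ring
    subst this; norm_num at hsum
  have hb1 : b = 1 := by
    have : (b - 1) * (b + 1) = 0 := mul_left_cancel₀ ha0 (by linear_combination -h1)
    rcases mul_eq_zero.1 this with h | h <;> linarith
  have ha1 : a = 1 := by subst hb1; linarith
  exact ⟨ha1, hb1⟩

end IsMovingFrame

end MovingFrames

/-! ### Existence: solving the system and reading off the invariants -/

section Existence

variable {lam : ℝ × ℝ → ℝ} {x X Y l : ℝ × ℝ → E3} {D : Set (ℝ × ℝ)} {p : ℝ × ℝ}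

/-- The operator `(x, X, Y, l) ↦ (s X, t Y + r l, -t X, -r X)`. -/
def uOperator (s t r : ℝ) : E3 × E3 × E3 × E3 →L[ℝ] E3 × E3 × E3 × E3 where
  toFun z := (s • z.2.1, t • z.2.2.1 + r • z.2.2.2, -t • z.2.1, -r • z.2.1)
  map_add' z w := by refine Prod.ext ?_ (Prod.ext ?_ (Prod.ext ?_ ?_)) <;> (simp; try module)
  map_smul' c z := by refine Prod.ext ?_ (Prod.ext ?_ (Prod.ext ?_ ?_)) <;> (simp; try module)
  cont := by fun_prop

/-- The operator `(x, X, Y, l) ↦ (s Y, -t Y, t X - r l, r Y)`. -/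
def vOperator (s t r : ℝ) : E3 × E3 × E3 × E3 →L[ℝ] E3 × E3 × E3 × E3 where
  toFun z := (s • z.2.2.1, -t • z.2.2.1, t • z.2.1 - r • z.2.2.2, r • z.2.2.1)
  map_add' z w := by refine Prod.ext ?_ (Prod.ext ?_ (Prod.ext ?_ ?_)) <;> (simp; try module)
  map_smul' c z := by refine Prod.ext ?_ (Prod.ext ?_ (Prod.ext ?_ ?_)) <;> (simp; try module)
  cont := by fun_prop

theorem uOperator_apply (s t r : ℝ) (z : E3 × E3 × E3 × E3) : uOperator s t r z =
    (s • z.2.1, t • z.2.2.1 + r • z.2.2.2, -t • z.2.1, -r • z.2.1) := rfl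

theorem vOperator_apply (s t r : ℝ) (z : E3 × E3 × E3 × E3) : vOperator s t r z =
    (s • z.2.2.1, -t • z.2.2.1, t • z.2.1 - r • z.2.2.2, r • z.2.2.1) := rfl

/-- `uOperator` depends linearly on its coefficients. -/
def uOperatorCLM : ℝ × ℝ × ℝ →L[ℝ] E3 × E3 × E3 × E3 →L[ℝ] E3 × E3 × E3 × E3 :=
  LinearMap.toContinuousLinearMap
    { toFun := fun a => uOperator a.1 a.2.1 a.2.2
      map_add' := fun a b => by
        refine ContinuousLinearMap.ext fun z => ?_
        simp only [uOperator_apply, add_apply, Prod.mk_add_mk, Prod.fst_add,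
          Prod.snd_add]
        refine Prod.ext ?_ (Prod.ext ?_ (Prod.ext ?_ ?_)) <;> simp only <;> module
      map_smul' := fun c a => by
        refine ContinuousLinearMap.ext fun z => ?_
        simp only [uOperator_apply, smul_apply, Prod.smul_mk, Prod.smul_fst,
          Prod.smul_snd, RingHom.id_apply, smul_eq_mul]
        refine Prod.ext ?_ (Prod.ext ?_ (Prod.ext ?_ ?_)) <;> simp only <;> module }

/-- `vOperator` depends linearly on its coefficients. -/
def vOperatorCLM : ℝ × ℝ × ℝ →L[ℝ] E3 × E3 × E3 × E3 →L[ℝ] E3 × E3 × E3 × E3 :=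
  LinearMap.toContinuousLinearMap
    { toFun := fun a => vOperator a.1 a.2.1 a.2.2
      map_add' := fun a b => by
        refine ContinuousLinearMap.ext fun z => ?_
        simp only [vOperator_apply, add_apply, Prod.mk_add_mk, Prod.fst_add,
          Prod.snd_add]
        refine Prod.ext ?_ (Prod.ext ?_ (Prod.ext ?_ ?_)) <;> simp only <;> module
      map_smul' := fun c a => by
        refine ContinuousLinearMap.ext fun z => ?_
        simp only [vOperator_apply, smul_apply, Prod.smul_mk, Prod.smul_fst,
          Prod.smul_snd, RingHom.id_apply, smul_eq_mul]
        refine Prod.ext ?_ (Prod.ext ?_ (Prod.ext ?_ ?_)) <;> simp only <;> module }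

theorem uOperatorCLM_apply (a : ℝ × ℝ × ℝ) :
    uOperatorCLM a = uOperator a.1 a.2.1 a.2.2 := rfl

theorem vOperatorCLM_apply (a : ℝ × ℝ × ℝ) :
    vOperatorCLM a = vOperator a.1 a.2.1 a.2.2 := rfl

theorem du_prodMk {V W : Type*} [NormedAddCommGroup V] [NormedSpace ℝ V] [NormedAddCommGroup W]
    [NormedSpace ℝ W] {f : ℝ × ℝ → V} {g : ℝ × ℝ → W} (hf : DifferentiableAt ℝ f p)
    (hg : DifferentiableAt ℝ g p) : du (fun q => (f q, g q)) p = (du f p, du g p) :=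
  congrArg (fun T : ℝ × ℝ →L[ℝ] V × W => T (1, 0)) (hf.fderiv_prodMk hg)

theorem dv_prodMk {V W : Type*} [NormedAddCommGroup V] [NormedSpace ℝ V] [NormedAddCommGroup W]
    [NormedSpace ℝ W] {f : ℝ × ℝ → V} {g : ℝ × ℝ → W} (hf : DifferentiableAt ℝ f p)
    (hg : DifferentiableAt ℝ g p) : dv (fun q => (f q, g q)) p = (dv f p, dv g p) :=
  congrArg (fun T : ℝ × ℝ →L[ℝ] V × W => T (0, 1)) (hf.fderiv_prodMk hg)

/-- Local solvability of the equations of the surface generated by a solution of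
`Δ lam = -exp lam`. -/
theorem exists_surface_and_movingFrame (hD : IsOpen D) (hlam : ContDiffOn ℝ 2 lam D)
    (heq : ∀ p ∈ D, laplacian lam p = -Real.exp (lam p)) (hp : p ∈ D) (a b c : E3) :
    ∃ r > 0, ball p r ⊆ D ∧ ∃ x X Y l : ℝ × ℝ → E3, X p = a ∧ Y p = b ∧ l p = c ∧
      (∀ q ∈ ball p r, DifferentiableAt ℝ x q ∧ du x q = speed lam q • X q ∧
        dv x q = speed lam q • Y q) ∧ IsMovingFrame lam X Y l (ball p r) := by
  have hlam1 : ContDiffOn ℝ 1 lam D := hlam.of_le (by norm_num)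
  have hσ : ContDiffOn ℝ 1 (speed lam) D := contDiffOn_speed hlam1
  have hτ : ContDiffOn ℝ 1 (normalSpeed lam) D := contDiffOn_normalSpeed hlam1
  have hlu : ContDiffOn ℝ 1 (fun q => du lam q / 2) D :=
    (contDiffOn_du hD hlam (by norm_num)).div_const 2
  have hlv : ContDiffOn ℝ 1 (fun q => dv lam q / 2) D :=
    (contDiffOn_dv hD hlam (by norm_num)).div_const 2
  have diff : ∀ {f : ℝ × ℝ → ℝ}, ContDiffOn ℝ 1 f D → ∀ q ∈ D, DifferentiableAt ℝ f q :=
    fun h q hq => (h.contDiffAt (hD.mem_nhds hq)).differentiableAt one_ne_zero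
  have half : ∀ {f : ℝ × ℝ → ℝ} {q : ℝ × ℝ}, DifferentiableAt ℝ f q →
      du (fun q => f q / 2) q = du f q / 2 ∧ dv (fun q => f q / 2) q = dv f q / 2 := by
    intro f q hf
    have : (fun q => f q / 2) = fun q => (2 : ℝ)⁻¹ • f q := by
      ext q; rw [smul_eq_mul]; ring
    rw [this, du_smul (differentiableAt_const _) hf, dv_smul (differentiableAt_const _) hf,
      du_const, dv_const]
    constructor <;> simp <;> ring
  obtain ⟨r, hr, hsub, f, hfp, hf⟩ := exists_local_solution hD
    (A := fun q => uOperatorCLM (speed lam q, dv lam q / 2, normalSpeed lam q))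
    (B := fun q => vOperatorCLM (speed lam q, du lam q / 2, normalSpeed lam q))
    (uOperatorCLM.contDiff.comp_contDiffOn (hσ.prodMk (hlv.prodMk hτ)))
    (vOperatorCLM.contDiff.comp_contDiffOn (hσ.prodMk (hlu.prodMk hτ)))
    -- The compatibility conditions. Those for x and l hold identically; those for X and Y require
    -- (λ_uu + λ_vv)/2 = -τ², which is the hypothesis on the Laplacian because 2τ² = e^λ.
    (fun q hq w => by
      have hdu := diff (contDiffOn_du hD hlam (m := 1) (by norm_num)) q hq
      have hdv := diff (contDiffOn_dv hD hlam (m := 1) (by norm_num)) q hq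
      rw [dv_clm_comp _ ((diff hσ q hq).prodMk ((diff hlv q hq).prodMk (diff hτ q hq))),
        du_clm_comp _ ((diff hσ q hq).prodMk ((diff hlu q hq).prodMk (diff hτ q hq))),
        du_prodMk (diff hσ q hq) ((diff hlu q hq).prodMk (diff hτ q hq)),
        dv_prodMk (diff hσ q hq) ((diff hlv q hq).prodMk (diff hτ q hq)),
        du_prodMk (diff hlu q hq) (diff hτ q hq), dv_prodMk (diff hlv q hq) (diff hτ q hq),
        du_speed (diff hlam1 q hq), dv_speed (diff hlam1 q hq),
        du_normalSpeed (diff hlam1 q hq), dv_normalSpeed (diff hlam1 q hq),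
        (half hdu).1, (half hdv).2]
      have hL := heq q hq
      rw [laplacian, ← two_mul_normalSpeed_sq] at hL
      have hL' : dv (dv lam) q = -(2 * normalSpeed lam q ^ 2) - du (du lam) q := by linarith
      rw [hL']
      simp only [uOperatorCLM_apply, vOperatorCLM_apply, uOperator_apply, vOperator_apply,
        Prod.mk_add_mk]
      refine Prod.ext ?_ (Prod.ext ?_ (Prod.ext ?_ ?_)) <;> simp only <;> module)
    hp (0, a, b, c)
  refine ⟨r, hr, hsub, fun q => (f q).1, fun q => (f q).2.1, fun q => (f q).2.2.1,
    fun q => (f q).2.2.2, by simp only [hfp], by simp only [hfp], by simp only [hfp], ?_, ?_⟩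
  all_goals
    have hπ : ∀ (π : E3 × E3 × E3 × E3 →L[ℝ] E3), ∀ q ∈ ball p r,
        DifferentiableAt ℝ (fun q => π (f q)) q ∧
        du (fun q => π (f q)) q =
          π (uOperator (speed lam q) (dv lam q / 2) (normalSpeed lam q) (f q)) ∧
        dv (fun q => π (f q)) q =
          π (vOperator (speed lam q) (du lam q / 2) (normalSpeed lam q) (f q)) := by
      intro π q hq
      obtain ⟨h1, h2, h3⟩ := hf q hq
      exact ⟨π.differentiableAt.comp q h1, by rw [du_clm_comp π h1, h2, uOperatorCLM_apply],
        by rw [dv_clm_comp π h1, h3, vOperatorCLM_apply]⟩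
  · exact fun q hq => hπ (ContinuousLinearMap.fst ℝ _ _) q hq
  · have hX := hπ ((ContinuousLinearMap.fst ℝ _ _).comp (ContinuousLinearMap.snd ℝ _ _))
    have hY := hπ ((ContinuousLinearMap.fst ℝ _ _).comp ((ContinuousLinearMap.snd ℝ _ _).comp
      (ContinuousLinearMap.snd ℝ _ _)))
    have hl := hπ ((ContinuousLinearMap.snd ℝ _ _).comp ((ContinuousLinearMap.snd ℝ _ _).comp
      (ContinuousLinearMap.snd ℝ _ _)))
    exact ⟨fun q hq => (hX q hq).1, fun q hq => (hY q hq).1, fun q hq => (hl q hq).1,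
      fun q hq => (hX q hq).2.1, fun q hq => (hX q hq).2.2, fun q hq => (hY q hq).2.1,
      fun q hq => (hY q hq).2.2, fun q hq => (hl q hq).2.1, fun q hq => (hl q hq).2.2⟩

/-- Solutions of the frame equations are as regular as `lam`. -/
theorem IsMovingFrame.contDiffOn (h : IsMovingFrame lam X Y l D) (hD : IsOpen D) {n : ℕ∞}
    (hlam : ContDiffOn ℝ n lam D) :
    ContDiffOn ℝ n X D ∧ ContDiffOn ℝ n Y D ∧ ContDiffOn ℝ n l D := by
  -- Bootstrap: if the frame is C^m and λ is C^(m+1), the right-hand sides are C^m, so the frame is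
  -- C^(m+1). Finite orders suffice, also for n = ∞.
  suffices H : ∀ m : ℕ, (m : WithTop ℕ∞) ≤ n →
      ContDiffOn ℝ m X D ∧ ContDiffOn ℝ m Y D ∧ ContDiffOn ℝ m l D by
    refine ⟨contDiffOn_iff_forall_nat_le.2 fun m hm => (H m (by exact_mod_cast hm)).1,
      contDiffOn_iff_forall_nat_le.2 fun m hm => (H m (by exact_mod_cast hm)).2.1,
      contDiffOn_iff_forall_nat_le.2 fun m hm => (H m (by exact_mod_cast hm)).2.2⟩
  intro m
  induction m with
  | zero =>
    intro _
    simp only [Nat.cast_zero, contDiffOn_zero]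
    exact ⟨fun p hp => (h.diffX p hp).continuousAt.continuousWithinAt,
      fun p hp => (h.diffY p hp).continuousAt.continuousWithinAt,
      fun p hp => (h.diffl p hp).continuousAt.continuousWithinAt⟩
  | succ m ih =>
    intro hm
    push_cast at hm ⊢
    have hm' : (m : WithTop ℕ∞) ≤ n := le_self_add.trans hm
    obtain ⟨hX, hY, hl⟩ := ih hm'
    have hτ : ContDiffOn ℝ m (normalSpeed lam) D := contDiffOn_normalSpeed (hlam.of_le hm')
    have hlu : ContDiffOn ℝ m (fun q => du lam q / 2) D := (contDiffOn_du hD hlam hm).div_const 2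
    have hlv : ContDiffOn ℝ m (fun q => dv lam q / 2) D := (contDiffOn_dv hD hlam hm).div_const 2
    exact ⟨contDiffOn_succ_of_du_dv (n := m) hD h.diffX
        (((hlv.smul hY).add (hτ.smul hl)).congr h.duX) ((hlu.neg.smul hY).congr h.dvX),
      contDiffOn_succ_of_du_dv (n := m) hD h.diffY
        ((hlv.neg.smul hX).congr h.duY) (((hlu.smul hX).sub (hτ.smul hl)).congr h.dvY),
      contDiffOn_succ_of_du_dv (n := m) hD h.diffl
        ((hτ.neg.smul hX).congr h.dul) ((hτ.smul hY).congr h.dvl)⟩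

/-- A surface whose principal frame solves the frame equations is generated by `lam`. -/
theorem isGeneratedBy_of_movingFrame (hD : IsOpen D) (hlam : ContDiffOn ℝ 2 lam D)
    (hne : ∀ p ∈ D, du lam p * dv lam p ≠ 0) (hx : ∀ p ∈ D, DifferentiableAt ℝ x p)
    (hxu : ∀ p ∈ D, du x p = speed lam p • X p) (hxv : ∀ p ∈ D, dv x p = speed lam p • Y p)
    (h : IsMovingFrame lam X Y l D) (hon : ∀ p ∈ D, IsRightFrame (X p) (Y p) (l p)) :
    IsGeneratedBy lam x D := by
  have hlamd : ∀ p ∈ D, DifferentiableAt ℝ lam p := fun p hp =>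
    (hlam.contDiffAt (hD.mem_nhds hp)).differentiableAt two_ne_zero
  have hσd : ∀ p ∈ D, DifferentiableAt ℝ (speed lam) p := fun p hp =>
    (hasFDerivAt_speed (hlamd p hp)).differentiableAt
  have hll : ∀ p ∈ D, inner ℝ (l p) (l p) = (1 : ℝ) := fun p hp => by
    rw [(hon p hp).eq_cross, inner_cross_self, (hon p hp).aa, (hon p hp).bb, (hon p hp).ab]
    norm_num
  have hXl : ∀ p ∈ D, inner ℝ (X p) (l p) = (0 : ℝ) := fun p hp => by
    rw [(hon p hp).eq_cross]; exact inner_cross_left _ _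
  have hYl : ∀ p ∈ D, inner ℝ (Y p) (l p) = (0 : ℝ) := fun p hp => by
    rw [(hon p hp).eq_cross]; exact inner_cross_right _ _
  have hnormal : ∀ p ∈ D, normal x p = l p := fun p hp => by
    have hl1 : ‖l p‖ = 1 := by
      rw [norm_eq_sqrt_real_inner, hll p hp, Real.sqrt_one]
    have hσ := speed_pos (lam := lam) (p := p)
    rw [normal, hxu p hp, hxv p hp, cross_smul_left, cross_smul_right, ← (hon p hp).eq_cross,
      smul_smul (speed lam p), norm_smul, hl1, mul_one, Real.norm_of_nonneg (by positivity),
      smul_smul, inv_mul_cancel₀ (by positivity), one_smul]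
  have huu : ∀ p ∈ D, du (du x) p = speed lam p • ((-(du lam p / 2)) • X p +
      (dv lam p / 2) • Y p + normalSpeed lam p • l p) := fun p hp => by
    rw [du_congr_of_isOpen hD hp hxu, du_smul (hσd p hp) (h.diffX p hp),
      du_speed (hlamd p hp), h.duX p hp]
    module
  have huv : ∀ p ∈ D, dv (du x) p = speed lam p • ((-(dv lam p / 2)) • X p +
      (-(du lam p / 2)) • Y p) := fun p hp => by
    rw [dv_congr_of_isOpen hD hp hxu, dv_smul (hσd p hp) (h.diffX p hp),
      dv_speed (hlamd p hp), h.dvX p hp]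
    module
  have hvv : ∀ p ∈ D, dv (dv x) p = speed lam p • ((du lam p / 2) • X p +
      (-(dv lam p / 2)) • Y p - normalSpeed lam p • l p) := fun p hp => by
    rw [dv_congr_of_isOpen hD hp hxv, dv_smul (hσd p hp) (h.diffY p hp),
      dv_speed (hlamd p hp), h.dvY p hp]
    module
  have hE : ∀ p ∈ D, coeffE x p = speed lam p ^ 2 := fun p hp => by
    rw [coeffE, hxu p hp, real_inner_smul_left, real_inner_smul_right, (hon p hp).aa]; ring
  have hF : ∀ p ∈ D, coeffF x p = 0 := fun p hp => by
    rw [coeffF, hxu p hp, hxv p hp, real_inner_smul_left, real_inner_smul_right, (hon p hp).ab]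
    ring
  have hG : ∀ p ∈ D, coeffG x p = speed lam p ^ 2 := fun p hp => by
    rw [coeffG, hxv p hp, real_inner_smul_left, real_inner_smul_right, (hon p hp).bb]; ring
  have hL : ∀ p ∈ D, coeffL x p = speed lam p * normalSpeed lam p := fun p hp => by
    simp only [coeffL, huu p hp, hnormal p hp, real_inner_smul_left, inner_add_left, hXl p hp,
      hYl p hp, hll p hp]
    ring
  have hM : ∀ p ∈ D, coeffM x p = 0 := fun p hp => by
    simp only [coeffM, huv p hp, hnormal p hp, real_inner_smul_left, inner_add_left, hXl p hp,
      hYl p hp]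
    ring
  have hN : ∀ p ∈ D, coeffN x p = -(speed lam p * normalSpeed lam p) := fun p hp => by
    simp only [coeffN, hvv p hp, hnormal p hp, real_inner_smul_left, inner_sub_left,
      inner_add_left, hXl p hp, hYl p hp, hll p hp]
    ring
  have hnX : ∀ p ∈ D, ‖du x p‖ = speed lam p := fun p hp => by
    rw [norm_eq_sqrt_real_inner]
    exact (congrArg Real.sqrt (hE p hp)).trans (Real.sqrt_sq speed_pos.le)
  have hnY : ∀ p ∈ D, ‖dv x p‖ = speed lam p := fun p hp => by
    rw [norm_eq_sqrt_real_inner]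
    exact (congrArg Real.sqrt (hG p hp)).trans (Real.sqrt_sq speed_pos.le)
  have hν₁ : ∀ p ∈ D, nu₁ x p = Real.exp (lam p) := fun p hp => by
    have hσ := speed_pos (lam := lam) (p := p)
    rw [nu₁, hL p hp, hE p hp, ← exp_mul_speed]
    field_simp
  have hν₂ : ∀ p ∈ D, nu₂ x p = -Real.exp (lam p) := fun p hp => by
    have hσ := speed_pos (lam := lam) (p := p)
    rw [nu₂, hN p hp, hG p hp, ← exp_mul_speed]
    field_simp
  -- The frame equations give γ₁ = λ_v/(2σ), and 1/(2σ) = τ; similarly for γ₂ below.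
  have hγ₁ : ∀ p ∈ D, gamma₁ x p = normalSpeed lam p * dv lam p := fun p hp => by
    have hσ := speed_pos (lam := lam) (p := p)
    have hlX : cross (l p) (X p) = Y p := by
      rw [(hon p hp).eq_cross, cross_cross_left, (hon p hp).aa, (hon p hp).ab]; simp
    rw [gamma₁, geodesicCurvature, hnX p hp, hnormal p hp, huu p hp, hxu p hp, cross_smul_right,
      hlX, div_eq_iff (by positivity)]
    simp only [real_inner_smul_left, real_inner_smul_right, inner_add_left, (hon p hp).ab,
      (hon p hp).bb, real_inner_comm (Y p) (l p), hYl p hp]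
    linear_combination (-(speed lam p) ^ 2 * dv lam p / 2) *
      two_mul_normalSpeed_mul_speed (lam := lam) (p := p)
  have hγ₂ : ∀ p ∈ D, gamma₂ x p = -(normalSpeed lam p * du lam p) := fun p hp => by
    have hσ := speed_pos (lam := lam) (p := p)
    have hlY : cross (l p) (Y p) = -X p := by
      rw [(hon p hp).eq_cross, cross_cross_right, (hon p hp).bb, (hon p hp).ab]; simp
    rw [gamma₂, geodesicCurvature, hnY p hp, hnormal p hp, hvv p hp, hxv p hp, cross_smul_right,
      hlY, div_eq_iff (by positivity)]
    simp only [real_inner_smul_left, real_inner_smul_right, inner_add_left, inner_sub_left,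
      inner_neg_right, real_inner_comm (X p) (Y p), (hon p hp).ab, (hon p hp).aa,
      real_inner_comm (X p) (l p), hXl p hp]
    linear_combination ((speed lam p) ^ 2 * du lam p / 2) *
      two_mul_normalSpeed_mul_speed (lam := lam) (p := p)
  -- With λ only C², the frame and σ are C², so x_u and x_v are C² and x reaches the required class
  -- C³.
  have hX2 := (h.contDiffOn hD (n := 2) hlam).1
  have hY2 := (h.contDiffOn hD (n := 2) hlam).2.1
  have hx3 : ContDiffOn ℝ 3 x D := by
    have := contDiffOn_succ_of_du_dv (n := 2) hD hx
      (((contDiffOn_speed hlam).smul hX2).congr hxu) (((contDiffOn_speed hlam).smul hY2).congr hxv)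
    exact this.of_le (by norm_num)
  refine ⟨⟨⟨hx3, fun p hp => ?_⟩, fun p hp => ⟨hF p hp, hM p hp⟩, fun p hp => ?_⟩, fun p hp => ?_,
    fun p hp => ⟨hν₁ p hp, hν₂ p hp, ?_, ?_⟩⟩
  · have hσ := speed_pos (lam := lam) (p := p)
    refine linearIndependent_of_ne_zero_of_inner_eq_zero (𝕜 := ℝ) (fun i => ?_)
      fun i j hij => ?_
    · fin_cases i
      · exact norm_ne_zero_iff.1 ((hnX p hp).trans_ne hσ.ne')
      · exact norm_ne_zero_iff.1 ((hnY p hp).trans_ne hσ.ne')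
    · have hF' : inner ℝ (du x p) (dv x p) = (0 : ℝ) := hF p hp
      fin_cases i <;> fin_cases j <;> simp_all [real_inner_comm]
  · have hτ := normalSpeed_pos (lam := lam) (p := p)
    have := hne p hp
    rw [hν₁ p hp, hν₂ p hp, hγ₁ p hp, hγ₂ p hp]
    have h2 : Real.exp (lam p) - -Real.exp (lam p) ≠ 0 := by
      have := Real.exp_pos (lam p); linarith
    exact mul_ne_zero (mul_ne_zero h2 (mul_ne_zero hτ.ne' (right_ne_zero_of_mul this)))
      (neg_ne_zero.2 (mul_ne_zero hτ.ne' (left_ne_zero_of_mul this)))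
  · rw [meanCurvature, hE p hp, hF p hp, hG p hp, hL p hp, hN p hp]
    ring
  · exact hγ₁ p hp
  · simp only [hγ₂ p hp, normalSpeed]; ring

end Existence

/-! ### From a surface with the given invariants to the frame equations -/

section Uniqueness

variable {lam : ℝ × ℝ → ℝ} {x : ℝ × ℝ → E3} {D : Set (ℝ × ℝ)}

theorem du_mul {f g : ℝ × ℝ → ℝ} {p : ℝ × ℝ} (hf : DifferentiableAt ℝ f p)
    (hg : DifferentiableAt ℝ g p) :
    du (fun q => f q * g q) p = du f p * g p + f p * du g p :=
  du_smul hf hg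

theorem dv_mul {f g : ℝ × ℝ → ℝ} {p : ℝ × ℝ} (hf : DifferentiableAt ℝ f p)
    (hg : DifferentiableAt ℝ g p) :
    dv (fun q => f q * g q) p = dv f p * g p + f p * dv g p :=
  dv_smul hf hg

/-- The unit normal, the vectors `l × x_u` and `l × x_v` at a point where `F = 0`. -/
theorem normal_of_inner_eq_zero {p : ℝ × ℝ} (ha : du x p ≠ 0) (hb : dv x p ≠ 0)
    (hab : inner ℝ (du x p) (dv x p) = (0 : ℝ)) :
    inner ℝ (normal x p) (normal x p) = (1 : ℝ) ∧ inner ℝ (normal x p) (du x p) = (0 : ℝ) ∧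
    inner ℝ (normal x p) (dv x p) = (0 : ℝ) ∧
    normal x p = (‖du x p‖ * ‖dv x p‖)⁻¹ • cross (du x p) (dv x p) ∧
    cross (normal x p) (du x p) = (‖du x p‖ / ‖dv x p‖) • dv x p ∧
    cross (normal x p) (dv x p) = -(‖dv x p‖ / ‖du x p‖) • du x p := by
  have ha' := norm_pos_iff.2 ha
  have hb' := norm_pos_iff.2 hb
  have hn : ‖cross (du x p) (dv x p)‖ = ‖du x p‖ * ‖dv x p‖ := by
    rw [norm_eq_sqrt_real_inner (cross _ _), inner_cross_self, hab, real_inner_self_eq_norm_sq,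
      real_inner_self_eq_norm_sq, ← Real.sqrt_sq (mul_nonneg ha'.le hb'.le)]
    congr 1; ring
  have hl : normal x p = (‖du x p‖ * ‖dv x p‖)⁻¹ • cross (du x p) (dv x p) := by
    rw [normal, hn]
  refine ⟨?_, ?_, ?_, hl, ?_, ?_⟩
  · rw [hl, real_inner_smul_left, real_inner_smul_right, inner_cross_self, hab,
      real_inner_self_eq_norm_sq, real_inner_self_eq_norm_sq]
    field_simp
    ring
  · rw [hl, real_inner_smul_left, real_inner_comm, inner_cross_left, mul_zero]
  · rw [hl, real_inner_smul_left, real_inner_comm, inner_cross_right, mul_zero]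
  · rw [hl, cross_smul_left, cross_cross_left, hab, real_inner_self_eq_norm_sq, zero_smul,
      sub_zero, smul_smul]
    congr 1
    field_simp
  · rw [hl, cross_smul_left, cross_cross_right, hab, real_inner_self_eq_norm_sq, zero_smul,
      zero_sub, smul_neg, smul_smul, neg_smul]
    congr 2
    field_simp

/-- The principal frame of a surface generated by `lam` satisfies the frame equations. -/
theorem IsGeneratedBy.isMovingFrame (hD : IsOpen D) (hlam : ∀ p ∈ D, DifferentiableAt ℝ lam p)
    (hne : ∀ p ∈ D, du lam p * dv lam p ≠ 0) (h : IsGeneratedBy lam x D) :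
    ∃ X Y l : ℝ × ℝ → E3, IsMovingFrame lam X Y l D ∧
      (∀ p ∈ D, IsRightFrame (X p) (Y p) (l p)) ∧
      ∀ p ∈ D, du x p = speed lam p • X p ∧ dv x p = speed lam p • Y p := by
  have hx3 := h.stronglyRegular.regular.contDiffOn
  have ha2 : ContDiffOn ℝ 2 (du x) D := contDiffOn_du hD hx3 (by norm_num)
  have hb2 : ContDiffOn ℝ 2 (dv x) D := contDiffOn_dv hD hx3 (by norm_num)
  have diff : ∀ {f : ℝ × ℝ → E3}, ContDiffOn ℝ 1 f D → ∀ q ∈ D, DifferentiableAt ℝ f q :=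
    fun h q hq => (h.contDiffAt (hD.mem_nhds hq)).differentiableAt one_ne_zero
  have hda := diff (ha2.of_le (by norm_num))
  have hdb := diff (hb2.of_le (by norm_num))
  have hdau := diff (contDiffOn_du hD ha2 (m := 1) (by norm_num))
  have hdav := diff (contDiffOn_dv hD ha2 (m := 1) (by norm_num))
  have hdbu := diff (contDiffOn_du hD hb2 (m := 1) (by norm_num))
  have hdbv := diff (contDiffOn_dv hD hb2 (m := 1) (by norm_num))
  have hba : ∀ p ∈ D, du (dv x) p = dv (du x) p := fun p hp =>
    du_dv_comm ((hx3.contDiffAt (hD.mem_nhds hp)).of_le (by norm_num))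
  have ha0 : ∀ p ∈ D, du x p ≠ 0 := fun p hp =>
    (h.stronglyRegular.regular.linearIndependent p hp).ne_zero 0
  have hb0 : ∀ p ∈ D, dv x p ≠ 0 := fun p hp =>
    (h.stronglyRegular.regular.linearIndependent p hp).ne_zero 1
  have hF : ∀ p ∈ D, inner ℝ (du x p) (dv x p) = (0 : ℝ) := fun p hp =>
    (h.stronglyRegular.principal p hp).1
  have hM : ∀ p ∈ D, inner ℝ (dv (du x) p) (normal x p) = (0 : ℝ) := fun p hp =>
    (h.stronglyRegular.principal p hp).2
  have hll : ∀ p ∈ D, inner ℝ (normal x p) (normal x p) = (1 : ℝ) := fun p hp =>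
    (normal_of_inner_eq_zero (ha0 p hp) (hb0 p hp) (hF p hp)).1
  have hla : ∀ p ∈ D, inner ℝ (normal x p) (du x p) = (0 : ℝ) := fun p hp =>
    (normal_of_inner_eq_zero (ha0 p hp) (hb0 p hp) (hF p hp)).2.1
  have hlb : ∀ p ∈ D, inner ℝ (normal x p) (dv x p) = (0 : ℝ) := fun p hp =>
    (normal_of_inner_eq_zero (ha0 p hp) (hb0 p hp) (hF p hp)).2.2.1
  have hl0 : ∀ p ∈ D, normal x p ≠ 0 := fun p hp h0 => by
    have := hll p hp
    rw [h0, inner_zero_left] at this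
    exact zero_ne_one this
  have hdl : ∀ p ∈ D, DifferentiableAt ℝ (normal x) p := fun p hp => by
    have hc := differentiableAt_cross (hda p hp) (hdb p hp)
    have hc0 : cross (du x p) (dv x p) ≠ 0 := fun h0 => hl0 p hp (by rw [normal, h0, smul_zero])
    exact ((hc.norm ℝ hc0).inv (norm_ne_zero_iff.2 hc0)).smul hc
  have hE : ∀ p ∈ D, 0 < (inner ℝ (du x p) (du x p) : ℝ) := fun p hp =>
    real_inner_self_pos.2 (ha0 p hp)
  have hG : ∀ p ∈ D, 0 < (inner ℝ (dv x p) (dv x p) : ℝ) := fun p hp =>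
    real_inner_self_pos.2 (hb0 p hp)
  have hL : ∀ p ∈ D, (inner ℝ (du (du x) p) (normal x p) : ℝ) =
      Real.exp (lam p) * inner ℝ (du x p) (du x p) := fun p hp =>
    (div_eq_iff (hE p hp).ne').1 (h.invariants p hp).1
  have hN : ∀ p ∈ D, (inner ℝ (dv (dv x) p) (normal x p) : ℝ) =
      -Real.exp (lam p) * inner ℝ (dv x p) (dv x p) := fun p hp =>
    (div_eq_iff (hG p hp).ne').1 (h.invariants p hp).2.1
  -- The derivatives of the relations `F = 0`, `⟨l, l⟩ = 1`, `⟨l, x_u⟩ = ⟨l, x_v⟩ = 0`.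
  have hFu : ∀ p ∈ D, (inner ℝ (du x p) (dv (du x) p) + inner ℝ (du (du x) p) (dv x p) : ℝ) = 0 :=
    fun p hp => by
      rw [← hba p hp, ← du_inner (hda p hp) (hdb p hp), du_congr_of_isOpen hD hp hF, du_const]
  have hFv : ∀ p ∈ D, (inner ℝ (du x p) (dv (dv x) p) + inner ℝ (dv (du x) p) (dv x p) : ℝ) = 0 :=
    fun p hp => by
      rw [← dv_inner (hda p hp) (hdb p hp), dv_congr_of_isOpen hD hp hF, dv_const]
  -- Rodrigues' formula l_u = -ν₁ x_u, checked by pairing with the orthogonal vectors x_u, x_v, l.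
  have hlu : ∀ p ∈ D, du (normal x) p = -Real.exp (lam p) • du x p := fun p hp => by
    have h1 := du_inner (hdl p hp) (hdl p hp)
    rw [du_congr_of_isOpen hD hp hll, du_const] at h1
    have h2 := du_inner (hdl p hp) (hda p hp)
    rw [du_congr_of_isOpen hD hp hla, du_const] at h2
    have h3 := du_inner (hdl p hp) (hdb p hp)
    rw [du_congr_of_isOpen hD hp hlb, du_const, hba p hp] at h3
    have hL' := hL p hp
    have hM' := hM p hp
    rw [real_inner_comm] at hL' hM'
    refine sub_eq_zero.1 (eq_zero_of_inner_eq_zero (ha0 p hp) (hb0 p hp) (hl0 p hp) (hF p hp)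
      (by rw [real_inner_comm]; exact hla p hp) (by rw [real_inner_comm]; exact hlb p hp) ?_ ?_ ?_)
      <;> rw [inner_sub_left, real_inner_smul_left]
    · linarith
    · rw [hF p hp]; linarith
    · rw [real_inner_comm (normal x p) (du x p), hla p hp]
      have := real_inner_comm (normal x p) (du (normal x) p)
      linarith
  have hlv : ∀ p ∈ D, dv (normal x) p = Real.exp (lam p) • dv x p := fun p hp => by
    have h1 := dv_inner (hdl p hp) (hdl p hp)
    rw [dv_congr_of_isOpen hD hp hll, dv_const] at h1
    have h2 := dv_inner (hdl p hp) (hda p hp)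
    rw [dv_congr_of_isOpen hD hp hla, dv_const] at h2
    have h3 := dv_inner (hdl p hp) (hdb p hp)
    rw [dv_congr_of_isOpen hD hp hlb, dv_const] at h3
    have hN' := hN p hp
    have hM' := hM p hp
    rw [real_inner_comm] at hN' hM'
    refine sub_eq_zero.1 (eq_zero_of_inner_eq_zero (ha0 p hp) (hb0 p hp) (hl0 p hp) (hF p hp)
      (by rw [real_inner_comm]; exact hla p hp) (by rw [real_inner_comm]; exact hlb p hp) ?_ ?_ ?_)
      <;> rw [inner_sub_left, real_inner_smul_left]
    · rw [real_inner_comm (du x p) (dv x p), hF p hp]; linarith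
    · linarith
    · rw [real_inner_comm (normal x p) (dv x p), hlb p hp]
      have := real_inner_comm (normal x p) (dv (normal x) p)
      linarith
  have hexp : ∀ p ∈ D, DifferentiableAt ℝ (fun q => Real.exp (lam q)) p := fun p hp =>
    (hlam p hp).exp
  have hexpu : ∀ p ∈ D, du (fun q => Real.exp (lam q)) p = Real.exp (lam p) * du lam p :=
    fun p hp => by rw [du, fderiv_exp (hlam p hp)]; rfl
  have hexpv : ∀ p ∈ D, dv (fun q => Real.exp (lam q)) p = Real.exp (lam p) * dv lam p :=
    fun p hp => by rw [dv, fderiv_exp (hlam p hp)]; rfl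
  -- The Codazzi equations.
  have hEv : ∀ p ∈ D, (2 * inner ℝ (du x p) (dv (du x) p) : ℝ) =
      -(dv lam p * inner ℝ (du x p) (du x p)) := fun p hp => by
    -- Differentiating M = 0 in u and L = e^λ E in v produces the same third derivative x_uuv;
    -- eliminating it leaves E_v = -λ_v E.
    have h1 := du_inner (hdav p hp) (hdl p hp)
    have hsymm : du (dv (du x)) p = dv (du (du x)) p :=
      du_dv_comm (ha2.contDiffAt (hD.mem_nhds hp))
    rw [du_congr_of_isOpen hD hp hM, du_const, hlu p hp, real_inner_smul_right, hsymm] at h1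
    have h2 := dv_inner (hdau p hp) (hdl p hp)
    rw [dv_congr_of_isOpen hD hp hL, hlv p hp, real_inner_smul_right,
      dv_mul (hexp p hp) ((hda p hp).inner ℝ (hda p hp)), dv_inner (hda p hp) (hda p hp),
      hexpv p hp] at h2
    have h3 := hFu p hp
    refine mul_left_cancel₀ (Real.exp_pos (lam p)).ne' ?_
    linear_combination h2 - h1 + Real.exp (lam p) * h3
  have hGu : ∀ p ∈ D, (2 * inner ℝ (dv x p) (dv (du x) p) : ℝ) =
      -(du lam p * inner ℝ (dv x p) (dv x p)) := fun p hp => by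
    have h1 := dv_inner (hdbu p hp) (hdl p hp)
    have hsymm : du (dv (dv x)) p = dv (du (dv x)) p :=
      du_dv_comm (hb2.contDiffAt (hD.mem_nhds hp))
    have hM' : ∀ p ∈ D, inner ℝ (du (dv x) p) (normal x p) = (0 : ℝ) := fun p hp => by
      rw [hba p hp]; exact hM p hp
    rw [dv_congr_of_isOpen hD hp hM', dv_const, hlv p hp, real_inner_smul_right, ← hsymm,
      hba p hp] at h1
    have h2 := du_inner (hdbv p hp) (hdl p hp)
    have hexpn : DifferentiableAt ℝ (fun q => -Real.exp (lam q)) p := (hexp p hp).neg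
    have hexpnu : du (fun q => -Real.exp (lam q)) p = -(Real.exp (lam p) * du lam p) := by
      rw [← hexpu p hp, du, du, fderiv_fun_neg]; rfl
    rw [du_congr_of_isOpen hD hp hN, hlu p hp, real_inner_smul_right,
      du_mul hexpn ((hdb p hp).inner ℝ (hdb p hp)), du_inner (hdb p hp) (hdb p hp),
      hexpnu, hba p hp] at h2
    have h3 := hFv p hp
    have h4 := real_inner_comm (dv x p) (dv (du x) p)
    have h5 := real_inner_comm (du x p) (dv (dv x) p)
    refine mul_left_cancel₀ (Real.exp_pos (lam p)).ne' ?_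
    linear_combination h1 - h2 + Real.exp (lam p) * (h3 - h4 + h5)
  -- The Codazzi equations determine the lengths of `x_u` and `x_v`.
  have hnb : ∀ p ∈ D, ‖dv x p‖ = speed lam p := fun p hp => by
    have h1 := (h.invariants p hp).2.2.1
    obtain ⟨-, -, -, -, hc, -⟩ := normal_of_inner_eq_zero (ha0 p hp) (hb0 p hp) (hF p hp)
    have ha' := norm_pos_iff.2 (ha0 p hp)
    have hb' := norm_pos_iff.2 (hb0 p hp)
    have h2 : (inner ℝ (du (du x) p) (dv x p) : ℝ) = dv lam p * ‖du x p‖ ^ 2 / 2 := by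
      have := hEv p hp
      rw [real_inner_self_eq_norm_sq] at this
      linarith [hFu p hp]
    rw [gamma₁, geodesicCurvature, hc, real_inner_smul_right, h2] at h1
    have hv0 : dv lam p ≠ 0 := right_ne_zero_of_mul (hne p hp)
    -- The Codazzi equation turns γ₁ into λ_v/(2√G); equating it with τλ_v and cancelling λ_v ≠ 0
    -- gives 2τ√G = 1.
    have h3 : 2 * normalSpeed lam p * ‖dv x p‖ = 1 := by
      have h1' : ‖du x p‖ / ‖dv x p‖ * (dv lam p * ‖du x p‖ ^ 2 / 2) / ‖du x p‖ ^ 3 =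
        normalSpeed lam p * dv lam p := h1
      field_simp at h1'
      linarith
    refine mul_left_cancel₀ (mul_pos two_pos (normalSpeed_pos (lam := lam) (p := p))).ne' ?_
    rw [h3, two_mul_normalSpeed_mul_speed]
  have hna : ∀ p ∈ D, ‖du x p‖ = speed lam p := fun p hp => by
    have h1 := (h.invariants p hp).2.2.2
    obtain ⟨-, -, -, -, -, hc⟩ := normal_of_inner_eq_zero (ha0 p hp) (hb0 p hp) (hF p hp)
    have ha' := norm_pos_iff.2 (ha0 p hp)
    have hb' := norm_pos_iff.2 (hb0 p hp)
    have h2 : (inner ℝ (dv (dv x) p) (du x p) : ℝ) = du lam p * ‖dv x p‖ ^ 2 / 2 := by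
      have := hGu p hp
      rw [real_inner_self_eq_norm_sq] at this
      have h4 := real_inner_comm (dv x p) (dv (du x) p)
      have h5 := real_inner_comm (du x p) (dv (dv x) p)
      linarith [hFv p hp]
    rw [gamma₂, geodesicCurvature, hc, real_inner_smul_right, h2] at h1
    have hu0 : du lam p ≠ 0 := left_ne_zero_of_mul (hne p hp)
    have h3 : 2 * normalSpeed lam p * ‖du x p‖ = 1 := by
      have h1' : -(‖dv x p‖ / ‖du x p‖) * (du lam p * ‖dv x p‖ ^ 2 / 2) / ‖dv x p‖ ^ 3 =
        -(normalSpeed lam p * du lam p) := h1.trans (by rw [normalSpeed]; ring)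
      field_simp at h1'
      linarith
    refine mul_left_cancel₀ (mul_pos two_pos (normalSpeed_pos (lam := lam) (p := p))).ne' ?_
    rw [h3, two_mul_normalSpeed_mul_speed]
  have hEσ : ∀ p ∈ D, (inner ℝ (du x p) (du x p) : ℝ) = speed lam p * speed lam p :=
    fun p hp => by rw [real_inner_self_eq_norm_mul_norm, hna p hp]
  have hGσ : ∀ p ∈ D, (inner ℝ (dv x p) (dv x p) : ℝ) = speed lam p * speed lam p :=
    fun p hp => by rw [real_inner_self_eq_norm_mul_norm, hnb p hp]
  have hσd : ∀ p ∈ D, DifferentiableAt ℝ (speed lam) p := fun p hp =>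
    (hasFDerivAt_speed (hlam p hp)).differentiableAt
  have hτd : ∀ p ∈ D, DifferentiableAt ℝ (fun q => 2 * normalSpeed lam q) p := fun p hp =>
    (hasFDerivAt_normalSpeed (hlam p hp)).differentiableAt.const_mul 2
  -- Expansion in the orthogonal basis x_u, x_v, l with E = G = σ²; it yields the Gauss formulas for
  -- x_uu, x_uv, x_vv.
  have hrep : ∀ p ∈ D, ∀ (w : E3) (α β γ : ℝ),
      inner ℝ w (du x p) = α * (speed lam p * speed lam p) →
      inner ℝ w (dv x p) = β * (speed lam p * speed lam p) → inner ℝ w (normal x p) = γ →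
      w = α • du x p + β • dv x p + γ • normal x p := fun p hp w α β γ h1 h2 h3 => by
    have hla' := hla p hp
    have hlb' := hlb p hp
    rw [real_inner_comm] at hla' hlb'
    have hba' := hF p hp
    rw [real_inner_comm] at hba'
    refine sub_eq_zero.1 (eq_zero_of_inner_eq_zero (ha0 p hp) (hb0 p hp) (hl0 p hp) (hF p hp)
      hla' hlb' ?_ ?_ ?_) <;>
      simp only [inner_sub_left, inner_add_left, real_inner_smul_left, h1, h2, h3, hF p hp, hba',
        hla p hp, hlb p hp, hla', hlb', hll p hp, hEσ p hp, hGσ p hp] <;> ring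
  have hauu : ∀ p ∈ D, du (du x) p = -(du lam p / 2) • du x p + (dv lam p / 2) • dv x p +
      (speed lam p * normalSpeed lam p) • normal x p := fun p hp => by
    refine hrep p hp _ _ _ _ ?_ ?_ ?_
    · have h1 := du_inner (hda p hp) (hda p hp)
      rw [du_congr_of_isOpen hD hp hEσ, du_mul (hσd p hp) (hσd p hp), du_speed (hlam p hp)] at h1
      linarith [real_inner_comm (du x p) (du (du x) p)]
    · have := hEv p hp
      rw [hEσ p hp] at this
      linarith [hFu p hp]
    · rw [hL p hp, hEσ p hp, ← exp_mul_speed]; ring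
  have hauv : ∀ p ∈ D, dv (du x) p = -(dv lam p / 2) • du x p + -(du lam p / 2) • dv x p +
      (0 : ℝ) • normal x p := fun p hp => by
    refine hrep p hp _ _ _ _ ?_ ?_ (hM p hp)
    · have := hEv p hp
      rw [hEσ p hp] at this
      linarith [real_inner_comm (du x p) (dv (du x) p)]
    · have := hGu p hp
      rw [hGσ p hp] at this
      linarith [real_inner_comm (dv x p) (dv (du x) p)]
  have hbvv : ∀ p ∈ D, dv (dv x) p = (du lam p / 2) • du x p + -(dv lam p / 2) • dv x p +
      -(speed lam p * normalSpeed lam p) • normal x p := fun p hp => by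
    refine hrep p hp _ _ _ _ ?_ ?_ ?_
    · have := hGu p hp
      rw [hGσ p hp] at this
      linarith [hFv p hp, real_inner_comm (dv x p) (dv (du x) p),
        real_inner_comm (du x p) (dv (dv x) p)]
    · have h1 := dv_inner (hdb p hp) (hdb p hp)
      rw [dv_congr_of_isOpen hD hp hGσ, dv_mul (hσd p hp) (hσd p hp), dv_speed (hlam p hp)] at h1
      linarith [real_inner_comm (dv x p) (dv (dv x) p)]
    · rw [hN p hp, hGσ p hp, ← exp_mul_speed]; ring
  have hτu : ∀ p ∈ D, du (fun q => 2 * normalSpeed lam q) p = normalSpeed lam p * du lam p :=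
    fun p hp => by
      rw [du_mul (differentiableAt_const _) (hasFDerivAt_normalSpeed (hlam p hp)).differentiableAt,
        du_const, du_normalSpeed (hlam p hp)]
      ring
  have hτv : ∀ p ∈ D, dv (fun q => 2 * normalSpeed lam q) p = normalSpeed lam p * dv lam p :=
    fun p hp => by
      rw [dv_mul (differentiableAt_const _) (hasFDerivAt_normalSpeed (hlam p hp)).differentiableAt,
        dv_const, dv_normalSpeed (hlam p hp)]
      ring
  have hστ : ∀ p, speed lam p * normalSpeed lam p = 1 / 2 := fun p => by
    linarith [two_mul_normalSpeed_mul_speed (lam := lam) (p := p)]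
  -- Since 2τ = 1/σ, these are the normalized tangent vectors, written without division.
  refine ⟨fun p => (2 * normalSpeed lam p) • du x p, fun p => (2 * normalSpeed lam p) • dv x p,
    normal x, ⟨fun p hp => (hτd p hp).smul (hda p hp), fun p hp => (hτd p hp).smul (hdb p hp), hdl,
      fun p hp => ?_, fun p hp => ?_, fun p hp => ?_, fun p hp => ?_, fun p hp => ?_,
      fun p hp => ?_⟩, fun p hp => ⟨?_, ?_, ?_, ?_⟩, fun p hp => ⟨?_, ?_⟩⟩
  · rw [du_smul (hτd p hp) (hda p hp), hτu p hp, hauu p hp, hστ]; module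
  · rw [dv_smul (hτd p hp) (hda p hp), hτv p hp, hauv p hp]; module
  · rw [du_smul (hτd p hp) (hdb p hp), hτu p hp, hba p hp, hauv p hp]; module
  · rw [dv_smul (hτd p hp) (hdb p hp), hτv p hp, hbvv p hp, hστ]; module
  · rw [hlu p hp, smul_smul, ← two_mul_normalSpeed_sq]; congr 1; ring
  · rw [hlv p hp, smul_smul, ← two_mul_normalSpeed_sq]; congr 1; ring
  · rw [real_inner_smul_left, real_inner_smul_right, hEσ p hp]
    linear_combination (2 * normalSpeed lam p * speed lam p + 1) *
      two_mul_normalSpeed_mul_speed (lam := lam) (p := p)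
  · rw [real_inner_smul_left, real_inner_smul_right, hGσ p hp]
    linear_combination (2 * normalSpeed lam p * speed lam p + 1) *
      two_mul_normalSpeed_mul_speed (lam := lam) (p := p)
  · rw [real_inner_smul_left, real_inner_smul_right, hF p hp, mul_zero, mul_zero]
  · obtain ⟨-, -, -, hn, -, -⟩ := normal_of_inner_eq_zero (ha0 p hp) (hb0 p hp) (hF p hp)
    rw [hn, cross_smul_left, cross_smul_right, smul_smul, hna p hp, hnb p hp]
    congr 1
    have hσ := speed_pos (lam := lam) (p := p)
    rw [inv_eq_iff_eq_inv, eq_comm, inv_eq_iff_eq_inv, eq_comm, inv_eq_of_mul_eq_one_left]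
    linear_combination (2 * normalSpeed lam p * speed lam p + 1) *
      two_mul_normalSpeed_mul_speed (lam := lam) (p := p)
  · rw [smul_smul, mul_comm, two_mul_normalSpeed_mul_speed, one_smul]
  · rw [smul_smul, mul_comm, two_mul_normalSpeed_mul_speed, one_smul]

end Uniqueness

/-! ### Rotations between frames, and the two assertions -/

section Motions

theorem IsRightFrame.inner_cc {a b c : E3} (h : IsRightFrame a b c) : inner ℝ c c = (1 : ℝ) := by
  rw [h.eq_cross, inner_cross_self, h.aa, h.bb, h.ab]; norm_num

theorem IsRightFrame.orthonormal {a b c : E3} (h : IsRightFrame a b c) :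
    Orthonormal ℝ ![a, b, c] := by
  have hac : inner ℝ a c = (0 : ℝ) := by rw [h.eq_cross]; exact inner_cross_left a b
  have hbc : inner ℝ b c = (0 : ℝ) := by rw [h.eq_cross]; exact inner_cross_right a b
  rw [orthonormal_iff_ite]
  intro i j
  fin_cases i <;> fin_cases j <;>
    simp [h.aa, h.bb, h.ab, h.inner_cc, hac, hbc, real_inner_comm a b, real_inner_comm a c,
      real_inner_comm b c, -inner_self_eq_norm_sq_to_K]

/-- The determinant is the triple product ⟨a × b, c⟩ = ⟨c, c⟩ = 1. -/
theorem IsRightFrame.det_eq_one {a b c : E3} (h : IsRightFrame a b c) :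
    (EuclideanSpace.basisFun (Fin 3) ℝ).toBasis.det ![a, b, c] = 1 := by
  have hc := h.inner_cc
  have hcr := h.eq_cross
  rw [Module.Basis.det_apply, Matrix.det_fin_three]
  simp only [Module.Basis.toMatrix_apply, OrthonormalBasis.coe_toBasis_repr_apply,
    EuclideanSpace.basisFun_repr, Matrix.cons_val_zero, Matrix.cons_val_one, Matrix.cons_val]
  have h0 : c 0 = a 1 * b 2 - a 2 * b 1 := by rw [hcr, cross_zero]
  have h1 : c 1 = a 2 * b 0 - a 0 * b 2 := by rw [hcr, cross_one]
  have h2 : c 2 = a 0 * b 1 - a 1 * b 0 := by rw [hcr, cross_two]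
  rw [inner_eq_sum] at hc
  linear_combination hc - c 0 * h0 - c 1 * h1 - c 2 * h2

/-- Two right oriented orthonormal frames are related by a rotation. -/
theorem exists_rotation {a b c a' b' c' : E3} (h : IsRightFrame a b c)
    (h' : IsRightFrame a' b' c') : ∃ g : E3 ≃ₗᵢ[ℝ] E3,
      LinearMap.det (g.toLinearEquiv : E3 →ₗ[ℝ] E3) = 1 ∧ g a = a' ∧ g b = b' ∧ g c = c' := by
  have hcard : Fintype.card (Fin 3) = Module.finrank ℝ E3 := by simp
  let B : OrthonormalBasis (Fin 3) ℝ E3 :=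
    OrthonormalBasis.mk h.orthonormal
      (h.orthonormal.linearIndependent.span_eq_top_of_card_eq_finrank hcard).ge
  let B' : OrthonormalBasis (Fin 3) ℝ E3 :=
    OrthonormalBasis.mk h'.orthonormal
      (h'.orthonormal.linearIndependent.span_eq_top_of_card_eq_finrank hcard).ge
  have hB : ⇑B = ![a, b, c] := OrthonormalBasis.coe_mk _ _
  have hB' : ⇑B' = ![a', b', c'] := OrthonormalBasis.coe_mk _ _
  have hg : ∀ i, B.equiv B' (Equiv.refl _) (![a, b, c] i) = ![a', b', c'] i := fun i => by
    rw [← hB, ← hB', OrthonormalBasis.equiv_apply_basis]; rfl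
  refine ⟨B.equiv B' (Equiv.refl _), ?_, hg 0, hg 1, hg 2⟩
  -- By multiplicativity, det g is the quotient of the determinants of the two frames, both equal to
  -- 1.
  have hdet := (EuclideanSpace.basisFun (Fin 3) ℝ).toBasis.det_comp
    ((B.equiv B' (Equiv.refl _)).toLinearEquiv : E3 →ₗ[ℝ] E3) ![a, b, c]
  have hcomp : ⇑((B.equiv B' (Equiv.refl _)).toLinearEquiv : E3 →ₗ[ℝ] E3) ∘ ![a, b, c] =
      ![a', b', c'] := funext hg
  rw [hcomp, h.det_eq_one, h'.det_eq_one, mul_one] at hdet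
  exact hdet.symm

/-- Two surfaces generated by the same function differ by a motion. -/
theorem IsGeneratedBy.exists_motion {lam : ℝ × ℝ → ℝ} {D : Set (ℝ × ℝ)} (hD : IsOpen D)
    (hc : IsConnected D) (hlam : ∀ p ∈ D, DifferentiableAt ℝ lam p)
    (hne : ∀ p ∈ D, du lam p * dv lam p ≠ 0) {x y : ℝ × ℝ → E3} (hx : IsGeneratedBy lam x D)
    (hy : IsGeneratedBy lam y D) : ∃ g : E3 ≃ᵃⁱ[ℝ] E3, IsMotion g ∧ ∀ p ∈ D, y p = g (x p) := by
  obtain ⟨p₀, hp₀⟩ := hc.nonempty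
  obtain ⟨X, Y, l, hf, hon, hd⟩ := hx.isMovingFrame hD hlam hne
  obtain ⟨X', Y', l', hf', hon', hd'⟩ := hy.isMovingFrame hD hlam hne
  obtain ⟨g, hg, hga, hgb, hgc⟩ := exists_rotation (hon p₀ hp₀) (hon' p₀ hp₀)
  have hxd : ∀ p ∈ D, DifferentiableAt ℝ x p := fun p hp =>
    (hx.stronglyRegular.regular.contDiffOn.contDiffAt (hD.mem_nhds hp)).differentiableAt
      three_ne_zero
  have hyd : ∀ p ∈ D, DifferentiableAt ℝ y p := fun p hp =>
    (hy.stronglyRegular.regular.contDiffOn.contDiffAt (hD.mem_nhds hp)).differentiableAt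
      three_ne_zero
  let L : E3 →L[ℝ] E3 := (g.toContinuousLinearEquiv : E3 →L[ℝ] E3)
  have hLx : ∀ p ∈ D, DifferentiableAt ℝ (fun q => L (x q)) p := fun p hp =>
    L.differentiableAt.comp p (hxd p hp)
  -- The rotated frame of x and the frame of y agree at p₀, hence on D; so L ∘ x and y have the same
  -- partial derivatives and differ by a constant.
  have heq : ∀ p ∈ D, y p - L (x p) = y p₀ - L (x p₀) := fun p hp => by
    refine hD.is_const_of_fderiv_eq_zero (𝕜 := ℝ) (f := fun q => y q - L (x q)) hc.isPreconnected
      (fun q hq => ((hyd q hq).sub (hLx q hq)).differentiableWithinAt) (fun q hq => ?_) hp hp₀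
    obtain ⟨h1, h2, -⟩ := (hf.map L).eq_of_eq hf' hD hc.isPreconnected hp₀ hq hga hgb hgc
    refine fderiv_eq_zero ?_ ?_
    · rw [du_sub (hyd q hq) (hLx q hq), du_clm_comp L (hxd q hq), (hd q hq).1, (hd' q hq).1,
        map_smul, h1, sub_self]
    · rw [dv_sub (hyd q hq) (hLx q hq), dv_clm_comp L (hxd q hq), (hd q hq).2, (hd' q hq).2,
        map_smul, h2, sub_self]
  -- The motion is the rotation followed by a translation; its linear part is g, so `hg` shows that
  -- it preserves orientation.
  refine ⟨g.toAffineIsometryEquiv.trans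
    (AffineIsometryEquiv.constVAdd ℝ E3 (y p₀ - L (x p₀))), hg, fun p hp => ?_⟩
  exact (sub_eq_iff_eq_add.1 (heq p hp))

/-- Local existence of a surface generated by a solution of `Δ lam = -exp lam`. -/
theorem exists_isGeneratedBy {n : ℕ∞} (hn : 2 ≤ n) {D : Set (ℝ × ℝ)} (hD : IsOpen D)
    {lam : ℝ × ℝ → ℝ} (hlam : ContDiffOn ℝ n lam D)
    (heq : ∀ p ∈ D, laplacian lam p = -Real.exp (lam p))
    (hne : ∀ p ∈ D, du lam p * dv lam p ≠ 0) {p : ℝ × ℝ} (hp : p ∈ D) :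
    ∃ r > 0, ball p r ⊆ D ∧ ∃ x : ℝ × ℝ → E3,
      ContDiffOn ℝ ((n + 1 : ℕ∞) : WithTop ℕ∞) x (ball p r) ∧ IsGeneratedBy lam x (ball p r) := by
  have hlam2 : ContDiffOn ℝ 2 lam D := hlam.of_le (WithTop.coe_le_coe.2 hn)
  let e : Fin 3 → E3 := fun i => EuclideanSpace.single i 1
  have h₀ : IsRightFrame (e 0) (e 1) (cross (e 0) (e 1)) :=
    ⟨by simp [e], by simp [e], by simp [e, inner_eq_sum], rfl⟩
  obtain ⟨r, hr, hsub, x, X, Y, l, hX, hY, hl, hx, hf⟩ :=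
    exists_surface_and_movingFrame hD hlam2 heq hp (e 0) (e 1) (cross (e 0) (e 1))
  rw [← hl, ← hX, ← hY] at h₀
  have hreg := hf.contDiffOn isOpen_ball (hlam.mono hsub)
  have hσ : ContDiffOn ℝ n (speed lam) (ball p r) := contDiffOn_speed (hlam.mono hsub)
  refine ⟨r, hr, hsub, x, ?_, isGeneratedBy_of_movingFrame isOpen_ball (hlam2.mono hsub)
    (fun q hq => hne q (hsub hq)) (fun q hq => (hx q hq).1) (fun q hq => (hx q hq).2.1)
    (fun q hq => (hx q hq).2.2) hf fun q hq => hf.isRightFrame isOpen_ball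
      (convex_ball p r).isPreconnected (mem_ball_self hr) hq h₀⟩
  -- The frame and σ are C^n, hence so are x_u and x_v, and x gains one derivative.
  have := contDiffOn_succ_of_du_dv isOpen_ball (fun q hq => (hx q hq).1)
    ((hσ.smul hreg.1).congr fun q hq => (hx q hq).2.1)
    ((hσ.smul hreg.2.1).congr fun q hq => (hx q hq).2.2)
  exact_mod_cast this

end Motions

end PrincipalSurface

end

theorem corollary5p2 (n : ℕ∞) (hn : 2 ≤ n) (D : Set (ℝ × ℝ)) (hD : IsOpen D)
    (lam : ℝ × ℝ → ℝ) (hlam : ContDiffOn ℝ (n : WithTop ℕ∞) lam D)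
    (heq : ∀ p ∈ D, PrincipalSurface.laplacian lam p = -Real.exp (lam p))
    (hne : ∀ p ∈ D, PrincipalSurface.du lam p * PrincipalSurface.dv lam p ≠ 0) :
    (∀ p ∈ D, ∃ D₀ : Set (ℝ × ℝ), D₀ ⊆ D ∧ IsOpen D₀ ∧ IsConnected D₀ ∧ p ∈ D₀ ∧
      ∃ x : ℝ × ℝ → PrincipalSurface.E3,
        ContDiffOn ℝ ((n + 1 : ℕ∞) : WithTop ℕ∞) x D₀ ∧
        PrincipalSurface.IsGeneratedBy lam x D₀) ∧
    (∀ D₀ : Set (ℝ × ℝ), D₀ ⊆ D → IsOpen D₀ → IsConnected D₀ →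
      ∀ x y : ℝ × ℝ → PrincipalSurface.E3,
        PrincipalSurface.IsGeneratedBy lam x D₀ → PrincipalSurface.IsGeneratedBy lam y D₀ →
        ∃ g : PrincipalSurface.E3 ≃ᵃⁱ[ℝ] PrincipalSurface.E3,
          PrincipalSurface.IsMotion g ∧ ∀ p ∈ D₀, y p = g (x p)) := by
  refine ⟨fun p hp => ?_, fun D₀ hsub hD₀ hc x y hx hy => ?_⟩
  · obtain ⟨r, hr, hsub, x, hx, hgen⟩ :=
      PrincipalSurface.exists_isGeneratedBy hn hD hlam heq hne hp
    exact ⟨Metric.ball p r, hsub, Metric.isOpen_ball,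
      ⟨⟨p, Metric.mem_ball_self hr⟩, (convex_ball p r).isPreconnected⟩, Metric.mem_ball_self hr,
      x, hx, hgen⟩
  · have hn0 : (n : WithTop ℕ∞) ≠ 0 := by
      have : n ≠ 0 := (zero_lt_two.trans_le hn).ne'
      exact_mod_cast this
    exact hx.exists_motion hD₀ hc (fun p hp => (hlam.contDiffAt
      (hD.mem_nhds (hsub hp))).differentiableAt hn0) (fun p hp => hne p (hsub hp)) hy
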